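/- Let $\mathcal C\subset[0,1]$ be the classical ternary Cantor set and $s=\frac{\log 2}{\log 3}$. For $0<\alpha<1$ define $\psi^\alpha_c:\mathbb R\to\mathbb R$ by $\psi^\alpha_c(x_1)=d(x_1,\mathcal C)^\alpha$ for $x_1\in(0,1)$ and $\psi^\alpha_c(x_1)=0$ otherwise, and put $$\Omega^+=\{(x_1,x_2)\in\mathbb R^2: x_2>\psi^\alpha_c(x_1)\},\qquad \Omega^-=\{(x_1,x_2)\in\mathbb R^2: x_2<\psi^\alpha_c(x_1)\}.$$ For an open set $\Omega\subset\mathbb R^2$ and $1\le p\le\infty$, $W^{1,p}(\Omega)$ is the set of all $u\in L^p(\Omega)$ that have a weak derivative $Du$ on $\Omega$ with $|Du|\in L^p(\Omega)$; $W^{1,q}_{\rm loc}(\mathbb R^2)$ is the set of functions that belong to $W^{1,q}(U)$ for every bounded open $U\subset\mathbb R^2$. An extension of $u\in W^{1,p}(\Omega)$ in the class $W^{1,q}_{\rm loc}(\mathbb R^2)$ is a function in $W^{1,q}_{\rm loc}(\mathbb R^2)$ that coincides with $u$ almost everywhere on $\Omega$. (1) Let $0<\alpha\le\frac{\log 2}{2\log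 3}$. Then for every $1\le p\le\infty$ there exist functions $u^-\in W^{1,p}(\Omega^-)$ and $u^+\in W^{1,p}(\Omega^+)$ which do not have extensions in the class $W^{1,1}_{\rm loc}(\mathbb R^2)$. (2) Let $\frac{\log 2}{2\log 3}<\alpha<1$. Then for every $1\le p\le\frac{1+\alpha-s}{2\alpha-s}$ there exist functions $u^-\in W^{1,p}(\Omega^-)$ and $u^+\in W^{1,p}(\Omega^+)$ which do not have extensions in the class $W^{1,1}_{\rm loc}(\mathbb R^2)$. (3) Let $\frac{\log 2}{2\log 3}<\alpha<1$. Then for every $\frac{1+\alpha-s}{2\alpha-s}<p<\infty$ and every $\frac{(1+\alpha-s)p}{(1+\alpha-s)+(1-\alpha)p}\le q<\infty$ there exist functions $u^-\in W^{1,p}(\Omega^-)$ and $u^+\in W^{1,p}(\Omega^+)$ which do not have extensions in the class $W^{1,q}_{\rm loc}(\mathbb R^2)$. -/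

import Mathlib

open MeasureTheory Set
open scoped ENNReal ContDiff

/-! Points of the plane are pairs `(x₁, x₂) : ℝ × ℝ`; `volume` is Lebesgue measure.  None of the
notions below depends on the choice of a norm on the plane. -/

/-- `v = (v₁, v₂)` is the weak derivative of `u` on the open set `Ω`: both are locally integrable
on `Ω`, and `∫_Ω η v = - ∫_Ω u Dη` (written in components) for every `η ∈ C_c^∞(Ω)`. -/
structure HasWeakGradientOn (Ω : Set (ℝ × ℝ)) (u : ℝ × ℝ → ℝ) (v : ℝ × ℝ → ℝ × ℝ) : Prop where
  locInt : LocallyIntegrableOn u Ω volume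
  locInt_grad : LocallyIntegrableOn v Ω volume
  fst : ∀ η : ℝ × ℝ → ℝ, ContDiff ℝ ∞ η → HasCompactSupport η → tsupport η ⊆ Ω →
    ∫ x in Ω, η x * (v x).1 = - ∫ x in Ω, u x * fderiv ℝ η x (1, 0)
  snd : ∀ η : ℝ × ℝ → ℝ, ContDiff ℝ ∞ η → HasCompactSupport η → tsupport η ⊆ Ω →
    ∫ x in Ω, η x * (v x).2 = - ∫ x in Ω, u x * fderiv ℝ η x (0, 1)

/-- `u ∈ W^{1,p}(Ω)`: `u ∈ L^p(Ω)`, and `u` has a weak derivative `Du` on `Ω` with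
`|Du| ∈ L^p(Ω)`.  (`MemLp v p` for a plane-valued `v` says that `v` is a.e. measurable and that
its norm is in `L^p`; all norms on the plane being equivalent, this is `|v| ∈ L^p`.)
Only the values of `u` on `Ω` matter. -/
def MemW1 (p : ℝ≥0∞) (Ω : Set (ℝ × ℝ)) (u : ℝ × ℝ → ℝ) : Prop :=
  MemLp u p (volume.restrict Ω) ∧
    ∃ v : ℝ × ℝ → ℝ × ℝ, HasWeakGradientOn Ω u v ∧ MemLp v p (volume.restrict Ω)

/-- `u ∈ W^{1,p}_loc(Ω)`: `u ∈ W^{1,p}(U)` for every bounded open `U` whose closure lies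
in `Ω`. -/
def MemW1Loc (p : ℝ≥0∞) (Ω : Set (ℝ × ℝ)) (u : ℝ × ℝ → ℝ) : Prop :=
  ∀ U : Set (ℝ × ℝ), IsOpen U → Bornology.IsBounded U → closure U ⊆ Ω → MemW1 p U u

/-- `u`, a function on `Ω`, has an extension in the class `W^{1,q}_loc(ℝ²)`: some
`w ∈ W^{1,q}_loc(ℝ²)` coincides with `u` almost everywhere on `Ω`. -/
def HasW1LocExtension (q : ℝ≥0∞) (Ω : Set (ℝ × ℝ)) (u : ℝ × ℝ → ℝ) : Prop :=
  ∃ w : ℝ × ℝ → ℝ, MemW1Loc q univ w ∧ w =ᵐ[volume.restrict Ω] u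

/-- The function `ψ(x) = d(x, 𝒞)^α` for `x ∈ (0, 1)` and `ψ(x) = 0` for all other real `x`,
where `𝒞` is the ternary Cantor set. -/
noncomputable def cantorPsi (α x : ℝ) : ℝ :=
  open Classical in if x ∈ Ioo (0 : ℝ) 1 then (Metric.infDist x cantorSet) ^ α else 0

/-- The domain above the graph of `ψ`. -/
def cantorUpper (α : ℝ) : Set (ℝ × ℝ) := {x | cantorPsi α x.1 < x.2}

/-- The domain below the graph of `ψ`. -/
def cantorLower (α : ℝ) : Set (ℝ × ℝ) := {x | x.2 < cantorPsi α x.1}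

/-- `log 2 / log 3`, the Hausdorff dimension of the ternary Cantor set. -/
noncomputable def cantorDim : ℝ := Real.log 2 / Real.log 3

/-! At heights of order `3 ^ (-α k)` the boundary graph cuts each of the `2 ^ k` Cantor intervals of
generation `k` into pieces that are disconnected at that height: fingers over the gaps for the lower
domain, slots over the Cantor points for the upper one. Let `u` equal `a k * φ (y / scale)` on one
piece per interval and `0` on the neighbouring piece. The edges of the pieces lie outside the
domain, so `u` has no horizontal derivative there, and its vertical derivative is of order `a k * 3
^ (α k)`. Hence `u` is in `W^{1,p}` as soon as `∑ (2/3) ^ k * 3 ^ (-α k) * (a k * 3 ^ (α k)) ^ p`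
converges (`memW1_levelSum`).

An extension must pass from `a k * φ` to `0` over a width of order `3 ^ (-k)`. Testing its weak
derivative on each interval and applying Hölder there shows that `∑ (2/3) ^ k * 3 ^ (-α k) * (a k *
3 ^ k) ^ q` converges (`le_lintegral_cantorCell`, `summable_of_hasW1LocExtension`).

It remains to choose `a k = 3 ^ (-γ k) * (k + 1) ^ (-d)` so that the first series converges and the
second diverges. As `2 = 3 ^ s` with `s` = `cantorDim`, the terms are `3 ^ (-e k) * (k + 1) ^ (-f)`
with `e = 1 + α - s + p (γ - α)`, respectively `e = 1 + α - s + q (γ - 1)`; the logarithmic factor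
`d` settles the critical exponents. -/

/-! ### Weak derivatives from pointwise partial derivatives. -/

/-- The product `u * η` is differentiable along entire lines, because it vanishes identically near
every point off `tsupport η`. On almost every line it and its derivative are integrable, so the
derivative integrates to zero; Fubini does the rest. Local integrability on the whole plane spares
any discussion of the slices of `Ω`. -/
theorem hasWeakGradientOn_of_hasDerivAt {Ω : Set (ℝ × ℝ)} {u : ℝ × ℝ → ℝ} {v : ℝ × ℝ → ℝ × ℝ}
    (hu : LocallyIntegrable u) (hv : LocallyIntegrable v)
    (h₁ : ∀ z ∈ Ω, HasDerivAt (fun x => u (x, z.2)) (v z).1 z.1)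
    (h₂ : ∀ z ∈ Ω, HasDerivAt (fun y => u (z.1, y)) (v z).2 z.2) :
    HasWeakGradientOn Ω u v := by
  have zero_off : ∀ {η : ℝ × ℝ → ℝ}, tsupport η ⊆ Ω → ∀ e : ℝ × ℝ, ∀ z, z ∉ Ω →
      η z = 0 ∧ fderiv ℝ η z e = 0 := by
    intro η hη e z hz
    have : z ∉ tsupport η := fun h => hz (hη h)
    refine ⟨image_eq_zero_of_notMem_tsupport this, ?_⟩
    rw [image_eq_zero_of_notMem_tsupport (fun h => this (tsupport_fderiv_subset ℝ h))]
    rfl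
  have integrable_aux : ∀ (η : ℝ × ℝ → ℝ) (g : ℝ × ℝ → ℝ) (e : ℝ × ℝ), ContDiff ℝ ∞ η →
      HasCompactSupport η → LocallyIntegrable g →
      Integrable (fun z => η z * g z) ∧ Integrable (fun z => u z * fderiv ℝ η z e) ∧
        Integrable (fun z => u z * η z) := by
    intro η g e hη hc hg
    refine ⟨hg.integrable_smul_left_of_hasCompactSupport hη.continuous hc,
      hu.integrable_smul_right_of_hasCompactSupport
        ((hη.continuous_fderiv (by simp)).clm_apply continuous_const) ?_,
      hu.integrable_smul_right_of_hasCompactSupport hη.continuous hc⟩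
    exact (hc.fderiv (𝕜 := ℝ)).comp_left (g := fun L : ℝ × ℝ →L[ℝ] ℝ => L e) rfl
  have main : ∀ (η : ℝ × ℝ → ℝ) (g : ℝ × ℝ → ℝ) (e : ℝ × ℝ), ContDiff ℝ ∞ η →
      HasCompactSupport η → tsupport η ⊆ Ω → LocallyIntegrable g →
      (∫ z, (η z * g z + u z * fderiv ℝ η z e) = 0) →
      ∫ z in Ω, η z * g z = - ∫ z in Ω, u z * fderiv ℝ η z e := by
    intro η g e hη hc hs hg h
    obtain ⟨i₁, i₂, -⟩ := integrable_aux η g e hη hc hg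
    rw [integral_add i₁ i₂] at h
    rw [setIntegral_eq_integral_of_forall_compl_eq_zero,
      setIntegral_eq_integral_of_forall_compl_eq_zero]
    · linarith
    · intro z hz
      simp [(zero_off hs e z hz).2]
    · intro z hz
      simp [(zero_off hs e z hz).1]
  have hv₁ : LocallyIntegrable (fun z => (v z).1) := fun z => by
    obtain ⟨s, hs, h⟩ := hv z
    exact ⟨s, hs, h.fst⟩
  have hv₂ : LocallyIntegrable (fun z => (v z).2) := fun z => by
    obtain ⟨s, hs, h⟩ := hv z
    exact ⟨s, hs, h.snd⟩
  refine ⟨hu.locallyIntegrableOn _, hv.locallyIntegrableOn _, ?_, ?_⟩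
  · intro η hη hc hs
    refine main η _ _ hη hc hs hv₁ ?_
    obtain ⟨i, i', i₂⟩ := integrable_aux η (fun z => (v z).1) (1, 0) hη hc hv₁
    have i₁ := i.fun_add i'
    rw [Measure.volume_eq_prod] at i₁ i₂ ⊢
    rw [integral_prod_symm _ i₁]
    refine integral_eq_zero_of_ae ?_
    filter_upwards [i₁.prod_left_ae, i₂.prod_left_ae] with y hy₁ hy₂
    refine integral_eq_zero_of_hasDerivAt_of_integrable (f := fun x => u (x, y) * η (x, y))
      (fun x => ?_) hy₁ hy₂
    have hd : HasDerivAt (fun x => η (x, y)) (fderiv ℝ η (x, y) (1, 0)) x := by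
      have h := (hη.differentiable (by simp) (x, y)).hasFDerivAt
      exact h.comp_hasDerivAt x ((hasDerivAt_id x).prodMk (hasDerivAt_const x y))
    by_cases hz : (x, y) ∈ tsupport η
    · exact ((h₁ _ (hs hz)).mul hd).congr_deriv (by ring)
    · have he : η (x, y) = 0 := image_eq_zero_of_notMem_tsupport hz
      have he' : fderiv ℝ η (x, y) (1, 0) = 0 := by
        rw [image_eq_zero_of_notMem_tsupport (fun h => hz (tsupport_fderiv_subset ℝ h))]
        rfl
      simp only [he, he', zero_mul, mul_zero, add_zero]
      refine (hasDerivAt_const x (0 : ℝ)).congr_of_eventuallyEq ?_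
      have h0 : η =ᶠ[nhds (x, y)] 0 := notMem_tsupport_iff_eventuallyEq.1 hz
      have hcont : Filter.Tendsto (fun x' : ℝ => (x', y)) (nhds x) (nhds (x, y)) :=
        (Continuous.prodMk continuous_id continuous_const).tendsto x
      filter_upwards [hcont.eventually h0] with x' hx'
      simp [hx']
  · intro η hη hc hs
    refine main η _ _ hη hc hs hv₂ ?_
    obtain ⟨i, i', i₂⟩ := integrable_aux η (fun z => (v z).2) (0, 1) hη hc hv₂
    have i₁ := i.fun_add i'
    rw [Measure.volume_eq_prod] at i₁ i₂ ⊢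
    rw [integral_prod _ i₁]
    refine integral_eq_zero_of_ae ?_
    filter_upwards [i₁.prod_right_ae, i₂.prod_right_ae] with x hx₁ hx₂
    refine integral_eq_zero_of_hasDerivAt_of_integrable (f := fun y => u (x, y) * η (x, y))
      (fun y => ?_) hx₁ hx₂
    have hd : HasDerivAt (fun y => η (x, y)) (fderiv ℝ η (x, y) (0, 1)) y := by
      have h := (hη.differentiable (by simp) (x, y)).hasFDerivAt
      exact h.comp_hasDerivAt y ((hasDerivAt_const y x).prodMk (hasDerivAt_id y))
    by_cases hz : (x, y) ∈ tsupport η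
    · exact ((h₂ _ (hs hz)).mul hd).congr_deriv (by ring)
    · have he : η (x, y) = 0 := image_eq_zero_of_notMem_tsupport hz
      have he' : fderiv ℝ η (x, y) (0, 1) = 0 := by
        rw [image_eq_zero_of_notMem_tsupport (fun h => hz (tsupport_fderiv_subset ℝ h))]
        rfl
      simp only [he, he', zero_mul, mul_zero, add_zero]
      refine (hasDerivAt_const y (0 : ℝ)).congr_of_eventuallyEq ?_
      have h0 : η =ᶠ[nhds (x, y)] 0 := notMem_tsupport_iff_eventuallyEq.1 hz
      have hcont : Filter.Tendsto (fun y' : ℝ => (x, y')) (nhds y) (nhds (x, y)) :=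
        (Continuous.prodMk continuous_const continuous_id).tendsto y
      filter_upwards [hcont.eventually h0] with y' hy'
      simp [hy']

/-! ### Self-similarity of the Cantor set. -/

/-- The numbers `n` such that `[n / 3 ^ k, (n + 1) / 3 ^ k]` is one of the `2 ^ k` intervals of
generation `k` in the construction of the Cantor set. -/
def cantorLeft : ℕ → Finset ℕ
  | 0 => {0}
  | k + 1 => cantorLeft k ∪ (cantorLeft k).image (· + 2 * 3 ^ k)

theorem cantorLeft_lt {k n : ℕ} (hn : n ∈ cantorLeft k) : n < 3 ^ k := by
  induction k generalizing n with
  | zero => simp_all [cantorLeft]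
  | succ k ih =>
    simp only [cantorLeft, Finset.mem_union, Finset.mem_image] at hn
    rw [pow_succ]
    obtain hn | ⟨n', hn, rfl⟩ := hn
    · have := ih hn
      omega
    · have := ih hn
      omega

theorem card_cantorLeft (k : ℕ) : (cantorLeft k).card = 2 ^ k := by
  induction k with
  | zero => simp [cantorLeft]
  | succ k ih =>
    rw [cantorLeft, Finset.card_union_of_disjoint,
      Finset.card_image_of_injective _ (add_left_injective _), ih, pow_succ]
    · ring
    · rw [Finset.disjoint_left]
      intro n hn hn'
      obtain ⟨n', -, rfl⟩ := Finset.mem_image.1 hn'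
      have := cantorLeft_lt hn
      have : 0 < 3 ^ k := by positivity
      omega

theorem div_three_mem_cantorSet {x : ℝ} (hx : x ∈ cantorSet) : x / 3 ∈ cantorSet := by
  rw [cantorSet_eq_union_halves]
  exact Or.inl ⟨x, hx, rfl⟩

theorem two_add_div_three_mem_cantorSet {x : ℝ} (hx : x ∈ cantorSet) :
    (2 + x) / 3 ∈ cantorSet := by
  rw [cantorSet_eq_union_halves]
  exact Or.inr ⟨x, hx, rfl⟩

theorem one_mem_cantorSet : (1 : ℝ) ∈ cantorSet := by
  refine mem_iInter.2 fun n => ?_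
  induction n with
  | zero => simp
  | succ n ih => exact Or.inr ⟨1, ih, by norm_num⟩

/-- The recursion for `cantorLeft` adds the leading ternary digit, not the last one, so each step is
exactly one of the maps `x ↦ x / 3` and `x ↦ (2 + x) / 3`. -/
theorem cantorLeft_rescale_mem {k n : ℕ} (hn : n ∈ cantorLeft k) {c : ℝ} (hc : c ∈ cantorSet) :
    (n + c) * (1 / 3) ^ k ∈ cantorSet := by
  induction k generalizing n with
  | zero =>
    obtain rfl : n = 0 := by simpa [cantorLeft] using hn
    simpa using hc
  | succ k ih =>
    simp only [cantorLeft, Finset.mem_union, Finset.mem_image] at hn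
    obtain hn | ⟨n', hn, rfl⟩ := hn
    · convert div_three_mem_cantorSet (ih hn) using 1
      ring
    · convert two_add_div_three_mem_cantorSet (ih hn) using 1
      have : (3 : ℝ) ^ k * (1 / 3) ^ k = 1 := by rw [← mul_pow]; norm_num
      push_cast
      linear_combination (2 / 3) * this

theorem mem_cantorSet_of_cantorLeft_rescale {k n : ℕ} (hn : n ∈ cantorLeft k) {z : ℝ}
    (hz : z ∈ Icc (0 : ℝ) 1) (h : (n + z) * (1 / 3) ^ k ∈ cantorSet) : z ∈ cantorSet := by
  induction k generalizing n with
  | zero =>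
    obtain rfl : n = 0 := by simpa [cantorLeft] using hn
    simpa using h
  | succ k ih =>
    simp only [cantorLeft, Finset.mem_union, Finset.mem_image] at hn
    have hk : (3 : ℝ) ^ k * (1 / 3) ^ k = 1 := by rw [← mul_pow]; norm_num
    have hr : (0 : ℝ) < (1 / 3) ^ k := by positivity
    rw [cantorSet_eq_union_halves, pow_succ] at h
    obtain hn | ⟨n', hn, rfl⟩ := hn
    · have hlt : (n : ℝ) + 1 ≤ 3 ^ k := by exact_mod_cast cantorLeft_lt hn
      obtain ⟨y, hy, he⟩ | ⟨y, hy, he⟩ := h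
      · refine ih hn ?_
        convert hy using 1
        simp only at he
        linarith
      · have := (cantorSet_subset_unitInterval hy).1
        simp only at he
        have h1 : ((n : ℝ) + z) * (1 / 3) ^ k ≤ 3 ^ k * (1 / 3) ^ k := by
          gcongr
          linarith [hz.2]
        linarith
    · push_cast at h
      have e : ((n' : ℝ) + 2 * 3 ^ k + z) * ((1 / 3) ^ k * (1 / 3))
          = (2 + (n' + z) * (1 / 3) ^ k) / 3 := by
        linear_combination (2 / 3) * hk
      rw [e] at h
      obtain ⟨y, hy, he⟩ | ⟨y, hy, he⟩ := h
      · have := (cantorSet_subset_unitInterval hy).2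
        simp only at he
        have : 0 ≤ ((n' : ℝ) + z) * (1 / 3) ^ k := by
          have := hz.1
          positivity
        linarith
      · refine ih hn ?_
        convert hy using 1
        simp only at he
        linarith

theorem notMem_cantorSet_middle {x : ℝ} (h₁ : 1 / 3 < x) (h₂ : x < 2 / 3) : x ∉ cantorSet := by
  rw [cantorSet_eq_union_halves]
  rintro (⟨y, hy, he⟩ | ⟨y, hy, he⟩) <;> have := cantorSet_subset_unitInterval hy <;>
    simp only [mem_Icc] at this he <;> linarith

theorem notMem_cantorSet_left {x : ℝ} (h₁ : 1 / 9 < x) (h₂ : x < 2 / 9) : x ∉ cantorSet := by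
  rw [cantorSet_eq_union_halves]
  rintro (⟨y, hy, he⟩ | ⟨y, hy, he⟩)
  · simp only at he
    exact notMem_cantorSet_middle (by linarith) (by linarith) hy
  · have := cantorSet_subset_unitInterval hy
    simp only [mem_Icc] at this he
    linarith

theorem notMem_cantorSet_right {x : ℝ} (h₁ : 7 / 9 < x) (h₂ : x < 8 / 9) : x ∉ cantorSet := by
  rw [cantorSet_eq_union_halves]
  rintro (⟨y, hy, he⟩ | ⟨y, hy, he⟩)
  · have := cantorSet_subset_unitInterval hy
    simp only [mem_Icc] at this he
    linarith
  · simp only at he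
    exact notMem_cantorSet_middle (by linarith) (by linarith) hy

theorem one_third_mem_cantorSet : (1 / 3 : ℝ) ∈ cantorSet :=
  div_three_mem_cantorSet one_mem_cantorSet

theorem two_thirds_mem_cantorSet : (2 / 3 : ℝ) ∈ cantorSet := by
  simpa using two_add_div_three_mem_cantorSet zero_mem_cantorSet

/-! ### Bounds for the boundary function near Cantor points and inside gaps. -/

theorem cantorPsi_nonneg (α x : ℝ) : 0 ≤ cantorPsi α x := by
  rw [cantorPsi]
  split_ifs
  · exact Real.rpow_nonneg Metric.infDist_nonneg _
  · exact le_rfl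

theorem measurable_cantorPsi (α : ℝ) : Measurable (cantorPsi α) := by
  unfold cantorPsi
  exact Measurable.ite measurableSet_Ioo ((Metric.continuous_infDist_pt _).measurable.pow_const α)
    measurable_const

theorem measurableSet_cantorLower (α : ℝ) : MeasurableSet (cantorLower α) :=
  measurableSet_lt measurable_snd ((measurable_cantorPsi α).comp measurable_fst)

theorem measurableSet_cantorUpper (α : ℝ) : MeasurableSet (cantorUpper α) :=
  measurableSet_lt ((measurable_cantorPsi α).comp measurable_fst) measurable_snd

theorem cantorPsi_le {α : ℝ} (hα : 0 < α) {x y : ℝ} (hy : y ∈ cantorSet) :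
    cantorPsi α x ≤ |x - y| ^ α := by
  rw [cantorPsi]
  split_ifs
  · exact Real.rpow_le_rpow Metric.infDist_nonneg (Metric.infDist_le_dist_of_mem hy) hα.le
  · positivity

theorem cantorPsi_eq_zero {α : ℝ} (hα : 0 < α) {x : ℝ} (hx : x ∈ cantorSet) :
    cantorPsi α x = 0 :=
  le_antisymm (by simpa [Real.zero_rpow hα.ne'] using cantorPsi_le hα hx (x := x))
    (cantorPsi_nonneg α x)

theorem cantorPsi_rescale_le {α : ℝ} (hα : 0 < α) {k n : ℕ} (hn : n ∈ cantorLeft k) {c : ℝ}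
    (hc : c ∈ cantorSet) {z δ : ℝ} (hz : |z - c| ≤ δ) :
    cantorPsi α ((n + z) * (1 / 3) ^ k) ≤ (δ * (1 / 3) ^ k) ^ α := by
  refine (cantorPsi_le hα (cantorLeft_rescale_mem hn hc)).trans
    (Real.rpow_le_rpow (abs_nonneg _) ?_ hα.le)
  have : ((n : ℝ) + z) * (1 / 3) ^ k - (n + c) * (1 / 3) ^ k = (z - c) * (1 / 3) ^ k := by ring
  rw [this, abs_mul, abs_of_nonneg (by positivity : (0 : ℝ) ≤ (1 / 3) ^ k)]
  gcongr

/-- A Cantor point closer than `δ / 3 ^ k` would, after magnification by `3 ^ k`, fall into the gap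
`(a, b)`. -/
theorem le_cantorPsi_rescale {α : ℝ} (hα : 0 < α) {k n : ℕ} (hn : n ∈ cantorLeft k)
    {a b δ z : ℝ} (ha : 0 ≤ a) (hb : b ≤ 1) (hab : ∀ x, a < x → x < b → x ∉ cantorSet)
    (hδ : 0 < δ) (haz : a + δ ≤ z) (hzb : z + δ ≤ b) :
    (δ * (1 / 3) ^ k) ^ α ≤ cantorPsi α ((n + z) * (1 / 3) ^ k) := by
  have hr : (0 : ℝ) < (1 / 3) ^ k := by positivity
  have hk : (3 : ℝ) ^ k * (1 / 3) ^ k = 1 := by rw [← mul_pow]; norm_num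
  have hlt : (n : ℝ) + 1 ≤ 3 ^ k := by exact_mod_cast cantorLeft_lt hn
  have hx : (n + z) * (1 / 3) ^ k ∈ Ioo (0 : ℝ) 1 := by
    refine ⟨by have : 0 < z := by linarith
               positivity, ?_⟩
    exact ((mul_lt_mul_iff_left₀ hr).2 (by linarith)).trans_eq hk
  rw [cantorPsi, if_pos hx]
  refine Real.rpow_le_rpow (by positivity) ?_ hα.le
  rw [Metric.le_infDist ⟨0, zero_mem_cantorSet⟩]
  intro y hy
  by_contra! hlt
  set w := y * 3 ^ k - n with hw
  have hyw : y = (n + w) * (1 / 3) ^ k := by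
    rw [hw]
    linear_combination (-y) * hk
  have : ((n : ℝ) + z) * (1 / 3) ^ k - (n + w) * (1 / 3) ^ k = (z - w) * (1 / 3) ^ k := by ring
  rw [Real.dist_eq, hyw, this, abs_mul, abs_of_pos hr, mul_lt_mul_iff_left₀ hr, abs_lt] at hlt
  exact hab w (by linarith) (by linarith)
    (mem_cantorSet_of_cantorLeft_rescale hn ⟨by linarith, by linarith⟩ (hyw ▸ hy))

/-! ### The geometry shared by the two domains. -/

/-- The union of the intervals `((n + l) / 3 ^ k, (n + m) / 3 ^ k)`, where `n / 3 ^ k` runs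
through the left endpoints of the intervals of generation `k`. -/
def cantorBlocks (l m : ℝ) (k : ℕ) : Set ℝ :=
  ⋃ n ∈ cantorLeft k, Ioo ((n + l) * (1 / 3 : ℝ) ^ k) ((n + m) * (1 / 3 : ℝ) ^ k)

/-- The interval of heights assigned to generation `k`. -/
def cantorHeights (α : ℝ) (k : ℕ) : Set ℝ :=
  Ioo ((1 / 54 * (1 / 3 : ℝ) ^ k) ^ α) ((1 / 27 * (1 / 3 : ℝ) ^ k) ^ α)

/-- What a domain `Ω` must satisfy for functions that are constant on horizontal segments of
`cantorBlocks l m k × cantorHeights α k` to be Sobolev on `Ω` but not extendable. -/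
structure CantorAdapted (α l m : ℝ) (Ω : Set (ℝ × ℝ)) : Prop where
  measurable : MeasurableSet Ω
  left_notMem : ∀ k, ∀ n ∈ cantorLeft k, ∀ y ∈ cantorHeights α k,
    ((n + l) * (1 / 3 : ℝ) ^ k, y) ∉ Ω
  right_notMem : ∀ k, ∀ n ∈ cantorLeft k, ∀ y ∈ cantorHeights α k,
    ((n + m) * (1 / 3 : ℝ) ^ k, y) ∉ Ω
  locally_finite : ∀ z ∈ Ω, ∃ N : ℕ, ∀ᶠ y in nhds z.2, ∀ k ≥ N, z.1 ∈ cantorBlocks l m k →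
    y ∉ cantorHeights α k
  mem : ∀ k, ∀ n ∈ cantorLeft k, ∀ y ∈ cantorHeights α k, ∀ x : ℝ,
    |x - m| ∈ Icc (1 / 6 - 1 / 100 : ℝ) (1 / 6 + 1 / 100) → ((n + x) * (1 / 3 : ℝ) ^ k, y) ∈ Ω

theorem tendsto_cantorHeights {α : ℝ} (hα : 0 < α) (c : ℝ) :
    Filter.Tendsto (fun k : ℕ => (c * (1 / 3 : ℝ) ^ k) ^ α) Filter.atTop (nhds 0) := by
  have h : Filter.Tendsto (fun k : ℕ => c * (1 / 3 : ℝ) ^ k) Filter.atTop (nhds 0) := by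
    simpa using (tendsto_pow_atTop_nhds_zero_of_lt_one (by norm_num : (0 : ℝ) ≤ 1 / 3)
      (by norm_num)).const_mul c
  simpa [Real.zero_rpow hα.ne'] using h.rpow_const (Or.inr hα.le)

theorem pos_of_mem_cantorHeights {α y : ℝ} {k : ℕ} (hy : y ∈ cantorHeights α k) : 0 < y :=
  lt_trans (by positivity) hy.1

theorem eventually_notMem_cantorHeights {α : ℝ} (hα : 0 < α) {y : ℝ} (hy : 0 < y) :
    ∃ N : ℕ, ∀ᶠ y' in nhds y, ∀ k ≥ N, y' ∉ cantorHeights α k := by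
  obtain ⟨N, hN⟩ := ((tendsto_cantorHeights hα (1 / 27)).eventually_lt_const hy).exists
  refine ⟨N, ?_⟩
  filter_upwards [lt_mem_nhds hN] with y' hy' k hk h
  refine absurd (h.2.trans_le ?_) hy'.not_gt
  exact Real.rpow_le_rpow (by positivity) (mul_le_mul_of_nonneg_left
    (pow_le_pow_of_le_one (by norm_num) (by norm_num) hk) (by norm_num)) hα.le

/-- The block is the finger over the middle gap; its edges are Cantor points, where `ψ` vanishes.
The points `m - 1/6 = 1/2` and `m + 1/6 = 5/6` are the midpoints of two different gaps. -/
theorem cantorAdapted_cantorLower {α : ℝ} (hα : 0 < α) :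
    CantorAdapted α (1 / 3) (2 / 3) (cantorLower α) where
  measurable := measurableSet_cantorLower α
  left_notMem k n hn y hy h := by
    rw [cantorLower, mem_ofPred_eq,
      cantorPsi_eq_zero hα (cantorLeft_rescale_mem hn one_third_mem_cantorSet)] at h
    exact h.not_gt (pos_of_mem_cantorHeights hy)
  right_notMem k n hn y hy h := by
    rw [cantorLower, mem_ofPred_eq,
      cantorPsi_eq_zero hα (cantorLeft_rescale_mem hn two_thirds_mem_cantorSet)] at h
    exact h.not_gt (pos_of_mem_cantorHeights hy)
  locally_finite z hz := by
    obtain hneg | hpos := lt_or_ge z.2 0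
    · refine ⟨0, ?_⟩
      filter_upwards [gt_mem_nhds hneg] with y hy k _ _ h
      exact hy.not_gt (pos_of_mem_cantorHeights h)
    -- The heights accumulate at `0`, which may be an interior height here. Finiteness comes from
    -- the abscissa instead: on blocks of generation `k` the function `ψ` is at most `(3 ^ (-k) / 3)
    -- ^ α`.
    · have hψ : 0 < cantorPsi α z.1 := hpos.trans_lt hz
      obtain ⟨N, hN⟩ := Filter.eventually_atTop.1
        ((tendsto_cantorHeights hα (1 / 3)).eventually_lt_const hψ)
      refine ⟨N, Filter.Eventually.of_forall fun y k hk hx => ?_⟩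
      exfalso
      simp only [cantorBlocks, mem_iUnion] at hx
      obtain ⟨n, hn, hx⟩ := hx
      have hr : (0 : ℝ) < (1 / 3) ^ k := by positivity
      have hb := cantorPsi_rescale_le hα hn one_third_mem_cantorSet
        (z := z.1 / (1 / 3) ^ k - n) (δ := 1 / 3) (by
          have h1 : (n : ℝ) + 1 / 3 < z.1 / (1 / 3) ^ k := by
            rw [lt_div_iff₀ hr]; exact hx.1
          have h2 : z.1 / (1 / 3) ^ k < (n : ℝ) + 2 / 3 := by
            rw [div_lt_iff₀ hr]; exact hx.2
          rw [abs_le]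
          constructor <;> linarith)
      rw [add_sub_cancel, div_mul_cancel₀ _ hr.ne'] at hb
      exact (hb.trans_lt (hN k hk)).false
  mem k n hn y hy x hx := by
    -- The gap `(7/9, 8/9)` has half-width `1/18`, and `1/18 - 1/100 > 1/27`; the middle gap leaves
    -- more room.
    have h : (1 / 27 * (1 / 3 : ℝ) ^ k) ^ α ≤ cantorPsi α ((n + x) * (1 / 3) ^ k) := by
      rcases le_total 0 (x - 2 / 3) with h0 | h0
      · rw [abs_of_nonneg h0] at hx
        exact le_cantorPsi_rescale hα hn (a := 7 / 9) (b := 8 / 9) (by norm_num) (by norm_num)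
          (fun _ => notMem_cantorSet_right) (by norm_num) (by linarith [hx.1]) (by linarith [hx.2])
      · rw [abs_of_nonpos h0] at hx
        exact le_cantorPsi_rescale hα hn (a := 1 / 3) (b := 2 / 3) (by norm_num) (by norm_num)
          (fun _ => notMem_cantorSet_middle) (by norm_num) (by linarith [hx.2]) (by linarith [hx.1])
    exact hy.2.trans_le h

/-- The roles are exchanged: the edges `1/6` and `1/2` are midpoints of gaps, where the graph rises
above the heights in question, while `m - 1/6 = 1/3` and `m + 1/6 = 2/3` are Cantor points. Within
`1/100 < 1/54` of these the graph stays below the heights. -/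
theorem cantorAdapted_cantorUpper {α : ℝ} (hα : 0 < α) :
    CantorAdapted α (1 / 6) (1 / 2) (cantorUpper α) where
  measurable := measurableSet_cantorUpper α
  left_notMem k n hn y hy h := by
    have := le_cantorPsi_rescale hα hn (a := 1 / 9) (b := 2 / 9) (δ := 1 / 27) (z := 1 / 6)
      (by norm_num) (by norm_num) (fun _ => notMem_cantorSet_left) (by norm_num) (by norm_num)
      (by norm_num)
    exact (hy.2.trans_le this).not_gt h
  right_notMem k n hn y hy h := by
    have := le_cantorPsi_rescale hα hn (a := 1 / 3) (b := 2 / 3) (δ := 1 / 27) (z := 1 / 2)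
      (by norm_num) (by norm_num) (fun _ => notMem_cantorSet_middle) (by norm_num) (by norm_num)
      (by norm_num)
    exact (hy.2.trans_le this).not_gt h
  locally_finite z hz := by
    obtain ⟨N, hN⟩ := eventually_notMem_cantorHeights hα ((cantorPsi_nonneg α z.1).trans_lt hz)
    exact ⟨N, hN.mono fun y hy k hk _ => hy k hk⟩
  mem k n hn y hy x hx := by
    have h : cantorPsi α ((n + x) * (1 / 3) ^ k) ≤ (1 / 54 * (1 / 3 : ℝ) ^ k) ^ α := by
      rcases le_total 0 (x - 1 / 2) with h0 | h0
      · rw [abs_of_nonneg h0] at hx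
        exact cantorPsi_rescale_le hα hn two_thirds_mem_cantorSet
          (abs_le.2 ⟨by linarith [hx.1], by linarith [hx.2]⟩)
      · rw [abs_of_nonpos h0] at hx
        exact cantorPsi_rescale_le hα hn one_third_mem_cantorSet
          (abs_le.2 ⟨by linarith [hx.2], by linarith [hx.1]⟩)
    exact h.trans_lt hy.1

/-! ### Sizes of the height intervals and of the blocks. -/

/-- The order of magnitude of the heights of generation `k`. -/
noncomputable def cantorScale (α : ℝ) (k : ℕ) : ℝ := ((1 / 3 : ℝ) ^ k) ^ α

theorem cantorScale_pos (α : ℝ) (k : ℕ) : 0 < cantorScale α k := by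
  unfold cantorScale
  positivity

theorem cantorScale_le_one {α : ℝ} (hα : 0 < α) (k : ℕ) : cantorScale α k ≤ 1 :=
  Real.rpow_le_one (by positivity) (pow_le_one₀ (by norm_num) (by norm_num)) hα.le

/-- The interval of the heights `y`, measured in units of `cantorScale α k`. -/
def cantorUnitHeights (α : ℝ) : Set ℝ := Ioo ((1 / 54) ^ α) ((1 / 27) ^ α)

theorem div_cantorScale_mem_iff {α : ℝ} {k : ℕ} {y : ℝ} :
    y / cantorScale α k ∈ cantorUnitHeights α ↔ y ∈ cantorHeights α k := by
  rw [cantorUnitHeights, cantorHeights, mem_Ioo, mem_Ioo, lt_div_iff₀ (cantorScale_pos α k),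
    div_lt_iff₀ (cantorScale_pos α k), Real.mul_rpow (by norm_num) (by positivity),
    Real.mul_rpow (by norm_num) (by positivity), cantorScale]

/-- The bases `1/54` and `1/27` differ by a factor `2`, less than the factor `3` between
generations. -/
theorem cantorHeights_disjoint_of_lt {α : ℝ} (hα : 0 < α) {j k : ℕ} (h : j < k) :
    Disjoint (cantorHeights α j) (cantorHeights α k) := by
  rw [disjoint_left]
  intro y hj hk
  refine (hk.2.trans_le ?_).not_gt hj.1
  refine Real.rpow_le_rpow (by positivity) ?_ hα.le
  have h1 : (1 / 3 : ℝ) ^ k ≤ (1 / 3) ^ (j + 1) :=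
    pow_le_pow_of_le_one (by norm_num) (by norm_num) h
  have h2 : (0 : ℝ) < (1 / 3) ^ j := by positivity
  rw [pow_succ] at h1
  linarith

theorem pairwise_disjoint_cantorHeights {α : ℝ} (hα : 0 < α) :
    Pairwise (Function.onFun Disjoint (cantorHeights α)) := by
  intro j k h
  obtain h | h := h.lt_or_gt
  · exact cantorHeights_disjoint_of_lt hα h
  · exact (cantorHeights_disjoint_of_lt hα h).symm

theorem measurableSet_cantorHeights (α : ℝ) (k : ℕ) : MeasurableSet (cantorHeights α k) :=
  measurableSet_Ioo

theorem volume_cantorHeights_le {α : ℝ} (hα : 0 < α) (k : ℕ) :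
    volume (cantorHeights α k) ≤ ENNReal.ofReal (cantorScale α k) := by
  rw [cantorHeights, Real.volume_Ioo]
  refine ENNReal.ofReal_le_ofReal ?_
  have h1 : (1 / 27 * (1 / 3 : ℝ) ^ k) ^ α ≤ cantorScale α k := by
    refine Real.rpow_le_rpow (by positivity) ?_ hα.le
    have h2 : (0 : ℝ) < (1 / 3) ^ k := by positivity
    linarith
  have h2 : 0 ≤ (1 / 54 * (1 / 3 : ℝ) ^ k) ^ α := by positivity
  linarith

theorem isOpen_cantorBlocks (l m : ℝ) (k : ℕ) : IsOpen (cantorBlocks l m k) :=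
  isOpen_biUnion fun _ _ => isOpen_Ioo

theorem volume_cantorBlocks_le {l m : ℝ} (hlm : m - l ≤ 1) (k : ℕ) :
    volume (cantorBlocks l m k) ≤ ENNReal.ofReal (2 ^ k * (1 / 3) ^ k) := by
  refine (measure_biUnion_finset_le _ _).trans ?_
  calc ∑ n ∈ cantorLeft k, volume (Ioo ((n + l) * (1 / 3 : ℝ) ^ k) ((n + m) * (1 / 3 : ℝ) ^ k))
      ≤ ∑ n ∈ cantorLeft k, ENNReal.ofReal ((1 / 3) ^ k) := by
        refine Finset.sum_le_sum fun n _ => ?_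
        rw [Real.volume_Ioo]
        refine ENNReal.ofReal_le_ofReal ?_
        have h : (0 : ℝ) < (1 / 3) ^ k := by positivity
        nlinarith
    _ = ENNReal.ofReal (2 ^ k * (1 / 3) ^ k) := by
        rw [Finset.sum_const, card_cantorLeft, nsmul_eq_mul, ENNReal.ofReal_mul (by positivity),
          ENNReal.ofReal_pow zero_le_two]
        norm_num

/-! ### The function on the domain and its Sobolev norm. -/

/-- A function of the height on each of the blocks of generation `k`. -/
noncomputable def levelTerm (α l m : ℝ) (a : ℕ → ℝ) (φ : ℝ → ℝ) (k : ℕ) (z : ℝ × ℝ) : ℝ :=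
  a k * φ (z.2 / cantorScale α k) * (cantorBlocks l m k).indicator 1 z.1

/-- The sum of `levelTerm` over all generations. -/
noncomputable def levelSum (α l m : ℝ) (a : ℕ → ℝ) (φ : ℝ → ℝ) (z : ℝ × ℝ) : ℝ :=
  ∑' k, levelTerm α l m a φ k z

section

variable {α l m : ℝ} {a : ℕ → ℝ} {φ : ℝ → ℝ}

theorem levelTerm_eq_zero (hφ : Function.support φ ⊆ cantorUnitHeights α) {k : ℕ} {z : ℝ × ℝ}
    (hz : z.1 ∈ cantorBlocks l m k → z.2 ∉ cantorHeights α k) : levelTerm α l m a φ k z = 0 := by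
  rw [levelTerm]
  by_cases h : z.1 ∈ cantorBlocks l m k
  · have : φ (z.2 / cantorScale α k) = 0 := by
      by_contra h0
      exact hz h (div_cantorScale_mem_iff.1 (hφ h0))
    simp [this]
  · simp [h]

theorem levelSum_eq_levelTerm (hα : 0 < α) (hφ : Function.support φ ⊆ cantorUnitHeights α)
    {k : ℕ} {z : ℝ × ℝ} (hz : z.2 ∈ cantorHeights α k) :
    levelSum α l m a φ z = levelTerm α l m a φ k z :=
  tsum_eq_single k fun _ hj => levelTerm_eq_zero hφ fun _ hz' =>
    (pairwise_disjoint_cantorHeights hα hj).le_bot ⟨hz', hz⟩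

theorem levelSum_eq_zero (hφ : Function.support φ ⊆ cantorUnitHeights α)
    {z : ℝ × ℝ} (hz : ∀ k, z.2 ∉ cantorHeights α k) : levelSum α l m a φ z = 0 := by
  rw [levelSum]
  simp [fun k => levelTerm_eq_zero (l := l) (m := m) (a := a) hφ fun _ => hz k]

theorem levelSum_eq_sum (hφ : Function.support φ ⊆ cantorUnitHeights α)
    {N : ℕ} {z : ℝ × ℝ} (hz : ∀ k ≥ N, z.1 ∈ cantorBlocks l m k → z.2 ∉ cantorHeights α k) :
    levelSum α l m a φ z = ∑ k ∈ Finset.range N, levelTerm α l m a φ k z :=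
  tsum_eq_sum fun k hk => levelTerm_eq_zero hφ (hz k (by simpa using hk))

theorem measurable_levelTerm (hc : Continuous φ) (k : ℕ) : Measurable (levelTerm α l m a φ k) := by
  unfold levelTerm
  have h : Measurable ((cantorBlocks l m k).indicator (1 : ℝ → ℝ)) :=
    measurable_one.indicator (isOpen_cantorBlocks l m k).measurableSet
  exact (measurable_const.mul (hc.measurable.comp (measurable_snd.div_const _))).mul
    (h.comp measurable_fst)

theorem hasSum_levelTerm (hα : 0 < α) (hφ : Function.support φ ⊆ cantorUnitHeights α)
    (z : ℝ × ℝ) : HasSum (fun k => levelTerm α l m a φ k z) (levelSum α l m a φ z) := by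
  by_cases h : ∃ k, z.2 ∈ cantorHeights α k
  · obtain ⟨k, hk⟩ := h
    rw [levelSum_eq_levelTerm hα hφ hk]
    exact hasSum_single k fun _ hj => levelTerm_eq_zero hφ fun _ hz' =>
      (pairwise_disjoint_cantorHeights hα hj).le_bot ⟨hz', hk⟩
  · push Not at h
    rw [levelSum_eq_zero hφ h]
    convert hasSum_zero with k
    exact levelTerm_eq_zero hφ fun _ => h k

theorem measurable_levelSum (hα : 0 < α) (hφ : Function.support φ ⊆ cantorUnitHeights α)
    (hc : Continuous φ) : Measurable (levelSum α l m a φ) :=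
  measurable_of_tendsto_metrizable
    (f := fun n z => ∑ k ∈ Finset.range n, levelTerm α l m a φ k z)
    (fun _ => Finset.measurable_sum _ fun k _ => measurable_levelTerm hc k)
    (tendsto_pi_nhds.2 fun z => (hasSum_levelTerm hα hφ z).tendsto_sum_nat)

/-- By disjointness of the heights at most one generation is nonzero at each point, so the power
passes through the sum without loss. -/
theorem enorm_levelSum_rpow_le (hα : 0 < α) (hφ : Function.support φ ⊆ cantorUnitHeights α)
    {p : ℝ} (hp : 0 < p) (z : ℝ × ℝ) :
    ‖levelSum α l m a φ z‖ₑ ^ p ≤ ∑' k, ‖levelTerm α l m a φ k z‖ₑ ^ p := by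
  by_cases h : ∃ k, z.2 ∈ cantorHeights α k
  · obtain ⟨k, hk⟩ := h
    rw [levelSum_eq_levelTerm hα hφ hk]
    exact ENNReal.le_tsum (f := fun k => ‖levelTerm α l m a φ k z‖ₑ ^ p) k
  · push Not at h
    rw [levelSum_eq_zero hφ h]
    simp [hp]

theorem abs_levelTerm_le {M : ℝ} (hM : ∀ y, |φ y| ≤ M) (k : ℕ) (z : ℝ × ℝ) :
    |levelTerm α l m a φ k z| ≤ |a k| * M := by
  rw [levelTerm, abs_mul, abs_mul]
  have h : |(cantorBlocks l m k).indicator (1 : ℝ → ℝ) z.1| ≤ 1 := by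
    by_cases h : z.1 ∈ cantorBlocks l m k <;> simp [h]
  calc |a k| * |φ (z.2 / cantorScale α k)| * |(cantorBlocks l m k).indicator (1 : ℝ → ℝ) z.1|
      ≤ |a k| * |φ (z.2 / cantorScale α k)| * 1 := by gcongr
    _ ≤ |a k| * M := by rw [mul_one]; exact mul_le_mul_of_nonneg_left (hM _) (abs_nonneg _)

theorem lintegral_levelTerm_le (hα : 0 < α) (hlm : m - l ≤ 1)
    (hφ : Function.support φ ⊆ cantorUnitHeights α) {M : ℝ} (hM : ∀ y, |φ y| ≤ M) {p : ℝ}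
    (hp : 0 < p) (k : ℕ) :
    ∫⁻ z, ‖levelTerm α l m a φ k z‖ₑ ^ p ≤
      ENNReal.ofReal (M ^ p * (2 ^ k * (1 / 3) ^ k * cantorScale α k * |a k| ^ p)) := by
  have hM0 : 0 ≤ M := (abs_nonneg _).trans (hM 0)
  have hsc := cantorScale_pos α k
  calc ∫⁻ z, ‖levelTerm α l m a φ k z‖ₑ ^ p
      ≤ ∫⁻ z, (cantorBlocks l m k ×ˢ cantorHeights α k).indicator
          (fun _ => ENNReal.ofReal ((|a k| * M) ^ p)) z := by
        refine lintegral_mono fun z => ?_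
        by_cases hz : z ∈ cantorBlocks l m k ×ˢ cantorHeights α k
        · rw [indicator_of_mem hz, ← ENNReal.ofReal_rpow_of_nonneg (by positivity) hp.le,
            Real.enorm_eq_ofReal_abs]
          exact ENNReal.rpow_le_rpow (ENNReal.ofReal_le_ofReal (abs_levelTerm_le hM k z)) hp.le
        · rw [levelTerm_eq_zero hφ fun h1 h2 => hz ⟨h1, h2⟩]
          simp [hp]
    _ = ENNReal.ofReal ((|a k| * M) ^ p) *
          (volume (cantorBlocks l m k) * volume (cantorHeights α k)) := by
        rw [lintegral_indicator ((isOpen_cantorBlocks l m k).measurableSet.prod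
          (measurableSet_cantorHeights α k)), setLIntegral_const, Measure.volume_eq_prod,
          Measure.prod_prod]
    _ ≤ ENNReal.ofReal ((|a k| * M) ^ p) *
          (ENNReal.ofReal (2 ^ k * (1 / 3) ^ k) * ENNReal.ofReal (cantorScale α k)) := by
        gcongr
        · exact volume_cantorBlocks_le hlm k
        · exact volume_cantorHeights_le hα k
    _ = _ := by
        rw [← ENNReal.ofReal_mul (by positivity), ← ENNReal.ofReal_mul (by positivity),
          Real.mul_rpow (abs_nonneg _) hM0]
        ring_nf

/-- The condition on the coefficients `a` under which `levelSum` is in `L^p`. -/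
def LevelSummable (α : ℝ) (p : ℝ≥0∞) (a : ℕ → ℝ) : Prop :=
  (p = ⊤ ∧ ∃ B, ∀ k, |a k| ≤ B) ∨
    (p ≠ ⊤ ∧ Summable fun k => 2 ^ k * (1 / 3) ^ k * cantorScale α k * |a k| ^ p.toReal)

theorem LevelSummable.mono {p : ℝ≥0∞} {b : ℕ → ℝ} (hb : LevelSummable α p b)
    (hab : ∀ k, |a k| ≤ |b k|) : LevelSummable α p a := by
  obtain ⟨hp, B, hB⟩ | ⟨hp, h⟩ := hb
  · exact Or.inl ⟨hp, B, fun k => (hab k).trans (hB k)⟩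
  · refine Or.inr ⟨hp, h.of_nonneg_of_le (fun k => ?_) fun k => ?_⟩
    · have := cantorScale_pos α k
      positivity
    · have := cantorScale_pos α k
      exact mul_le_mul_of_nonneg_left (Real.rpow_le_rpow (abs_nonneg _) (hab k)
        ENNReal.toReal_nonneg) (by positivity)

theorem memLp_levelSum (hα : 0 < α) (hlm : m - l ≤ 1)
    (hφ : Function.support φ ⊆ cantorUnitHeights α) (hc : Continuous φ) {M : ℝ}
    (hM : ∀ y, |φ y| ≤ M) {p : ℝ≥0∞} (hp : 1 ≤ p) (ha : LevelSummable α p a) :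
    MemLp (levelSum α l m a φ) p := by
  have hmeas := (measurable_levelSum (l := l) (m := m) (a := a) hα hφ hc).aestronglyMeasurable
    (μ := (volume : Measure (ℝ × ℝ)))
  obtain ⟨rfl, B, hB⟩ | ⟨hp', h⟩ := ha
  · have hM0 : 0 ≤ M := (abs_nonneg _).trans (hM 0)
    have hB0 : 0 ≤ B := (abs_nonneg _).trans (hB 0)
    refine memLp_top_of_bound hmeas (B * M) (Filter.Eventually.of_forall fun z => ?_)
    by_cases h : ∃ k, z.2 ∈ cantorHeights α k
    · obtain ⟨k, hk⟩ := h
      rw [levelSum_eq_levelTerm hα hφ hk, Real.norm_eq_abs]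
      exact (abs_levelTerm_le hM k z).trans (mul_le_mul_of_nonneg_right (hB k) hM0)
    · push Not at h
      rw [levelSum_eq_zero hφ h, norm_zero]
      positivity
  · have hp0 : p ≠ 0 := (zero_lt_one.trans_le hp).ne'
    have hpos : 0 < p.toReal := ENNReal.toReal_pos hp0 hp'
    refine ⟨hmeas, (eLpNorm_lt_top_iff_lintegral_rpow_enorm_lt_top hp0 hp').2 ?_⟩
    calc ∫⁻ z, ‖levelSum α l m a φ z‖ₑ ^ p.toReal
        ≤ ∫⁻ z, ∑' k, ‖levelTerm α l m a φ k z‖ₑ ^ p.toReal :=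
          lintegral_mono fun z => enorm_levelSum_rpow_le hα hφ hpos z
      _ = ∑' k, ∫⁻ z, ‖levelTerm α l m a φ k z‖ₑ ^ p.toReal :=
          lintegral_tsum fun k => ((measurable_levelTerm hc k).enorm.pow_const _).aemeasurable
      _ ≤ ∑' k, ENNReal.ofReal
            (M ^ p.toReal * (2 ^ k * (1 / 3) ^ k * cantorScale α k * |a k| ^ p.toReal)) :=
          ENNReal.tsum_le_tsum fun k => lintegral_levelTerm_le hα hlm hφ hM hpos k
      _ < ⊤ := (h.mul_left _).tsum_ofReal_lt_top

/-- The indicator of the blocks jumps only at block edges, and these are outside `Ω` at the heights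
where the term is nonzero. -/
theorem hasDerivAt_levelSum_fst {Ω : Set (ℝ × ℝ)} (hα : 0 < α) (hΩ : CantorAdapted α l m Ω)
    (hφ : Function.support φ ⊆ cantorUnitHeights α) {z : ℝ × ℝ} (hz : z ∈ Ω) :
    HasDerivAt (fun x => levelSum α l m a φ (x, z.2)) 0 z.1 := by
  by_cases h : ∃ k, z.2 ∈ cantorHeights α k
  · obtain ⟨k, hk⟩ := h
    have hconst : ∀ᶠ x in nhds z.1, (cantorBlocks l m k).indicator (1 : ℝ → ℝ) x =
        (cantorBlocks l m k).indicator 1 z.1 := by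
      by_cases hx : z.1 ∈ cantorBlocks l m k
      · filter_upwards [(isOpen_cantorBlocks l m k).mem_nhds hx] with x hx'
        simp [hx, hx']
      · have hclosed : IsClosed (⋃ n ∈ cantorLeft k,
            Icc ((n + l) * (1 / 3 : ℝ) ^ k) ((n + m) * (1 / 3 : ℝ) ^ k)) :=
          (cantorLeft k).finite_toSet.isClosed_biUnion fun _ _ => isClosed_Icc
        have hmem : z.1 ∉ ⋃ n ∈ cantorLeft k,
            Icc ((n + l) * (1 / 3 : ℝ) ^ k) ((n + m) * (1 / 3 : ℝ) ^ k) := by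
          simp only [mem_iUnion, not_exists]
          intro n hn hxn
          obtain h1 | h1 := hxn.1.eq_or_lt
          · exact hΩ.left_notMem k n hn _ hk (by rw [h1]; exact hz)
          obtain h2 | h2 := hxn.2.eq_or_lt
          · exact hΩ.right_notMem k n hn _ hk (by rw [← h2]; exact hz)
          · exact hx (mem_biUnion hn ⟨h1, h2⟩)
        filter_upwards [hclosed.isOpen_compl.mem_nhds hmem] with x hx'
        have : x ∉ cantorBlocks l m k := fun h =>
          hx' (iUnion₂_mono (fun _ _ => Ioo_subset_Icc_self) h)
        simp [hx, this]
    refine (hasDerivAt_const z.1 (levelTerm α l m a φ k z)).congr_of_eventuallyEq ?_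
    filter_upwards [hconst] with x hx
    rw [levelSum_eq_levelTerm (z := (x, z.2)) hα hφ hk, levelTerm, levelTerm, hx]
  · push Not at h
    refine (hasDerivAt_const z.1 (0 : ℝ)).congr_of_eventuallyEq (Filter.Eventually.of_forall ?_)
    intro x
    exact levelSum_eq_zero hφ h

/-- Local finiteness turns the series into one finite sum near `z.2`, so it can be differentiated
termwise; the chain rule replaces `a k` by `a k / cantorScale α k`. -/
theorem hasDerivAt_levelSum_snd {Ω : Set (ℝ × ℝ)} (hΩ : CantorAdapted α l m Ω)
    (hφ : tsupport φ ⊆ cantorUnitHeights α) (hd : Differentiable ℝ φ) {z : ℝ × ℝ} (hz : z ∈ Ω) :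
    HasDerivAt (fun y => levelSum α l m a φ (z.1, y))
      (levelSum α l m (fun k => a k / cantorScale α k) (deriv φ) z) z.2 := by
  obtain ⟨N, hN⟩ := hΩ.locally_finite z hz
  rw [levelSum_eq_sum (support_deriv_subset.trans hφ) hN.self_of_nhds]
  have h : HasDerivAt (fun y => ∑ k ∈ Finset.range N, levelTerm α l m a φ k (z.1, y))
      (∑ k ∈ Finset.range N,
        levelTerm α l m (fun k => a k / cantorScale α k) (deriv φ) k z) z.2 := by
    refine HasDerivAt.fun_sum fun k _ => ?_
    unfold levelTerm
    have h1 : HasDerivAt (fun y => φ (y / cantorScale α k))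
        (deriv φ (z.2 / cantorScale α k) * (1 / cantorScale α k)) z.2 :=
      (hd _).hasDerivAt.comp z.2 ((hasDerivAt_id z.2).div_const _)
    have h2 := (h1.const_mul (a k)).mul_const ((cantorBlocks l m k).indicator (1 : ℝ → ℝ) z.1)
    exact h2.congr_deriv (by ring)
  refine h.congr_of_eventuallyEq ?_
  filter_upwards [hN] with y hy
  exact levelSum_eq_sum ((subset_tsupport φ).trans hφ) hy

theorem memW1_levelSum {Ω : Set (ℝ × ℝ)} (hα : 0 < α) (hlm : m - l ≤ 1)
    (hΩ : CantorAdapted α l m Ω) (hφ : tsupport φ ⊆ cantorUnitHeights α)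
    (hc : HasCompactSupport φ) (hd : ContDiff ℝ 1 φ) {p : ℝ≥0∞} (hp : 1 ≤ p)
    (ha : LevelSummable α p fun k => a k / cantorScale α k) :
    MemW1 p Ω (levelSum α l m a φ) := by
  obtain ⟨M, hM⟩ := hc.exists_bound_of_continuous hd.continuous
  obtain ⟨M', hM'⟩ := hc.deriv.exists_bound_of_continuous (hd.continuous_deriv le_rfl)
  have hs := (subset_tsupport φ).trans hφ
  have hs' := (support_deriv_subset (f := φ)).trans hφ
  have hu : MemLp (levelSum α l m a φ) p := by
    refine memLp_levelSum hα hlm hs hd.continuous hM hp (ha.mono fun k => ?_)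
    rw [abs_div, abs_of_pos (cantorScale_pos α k)]
    exact le_div_self (abs_nonneg _) (cantorScale_pos α k) (cantorScale_le_one hα k)
  have hv₂ : MemLp (levelSum α l m (fun k => a k / cantorScale α k) (deriv φ)) p :=
    memLp_levelSum hα hlm hs' (hd.continuous_deriv le_rfl) hM' hp ha
  have hv : MemLp (fun z => ((0 : ℝ),
      levelSum α l m (fun k => a k / cantorScale α k) (deriv φ) z)) p :=
    MemLp.of_le hv₂ (aestronglyMeasurable_const.prodMk hv₂.1)
      (Filter.Eventually.of_forall fun z => by simp [Prod.norm_def])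
  exact ⟨hu.restrict Ω, _, hasWeakGradientOn_of_hasDerivAt (hu.locallyIntegrable hp)
    (hv.locallyIntegrable hp) (fun z hz => hasDerivAt_levelSum_fst hα hΩ hs hz)
    (fun z hz => hasDerivAt_levelSum_snd hΩ hφ (hd.differentiable one_ne_zero) hz), hv.restrict Ω⟩

end

/-! ### Detecting the jump with one test function per cell. -/

/-- The product of the interval `[n / 3 ^ k, (n + 1) / 3 ^ k)` with the heights of
generation `k`. -/
def cantorCell (α : ℝ) (k n : ℕ) : Set (ℝ × ℝ) :=
  Ico (n * (1 / 3 : ℝ) ^ k) ((n + 1) * (1 / 3 : ℝ) ^ k) ×ˢ cantorHeights α k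

theorem mem_Ico_rescale_iff {k n : ℕ} {x : ℝ} :
    x ∈ Ico (n * (1 / 3 : ℝ) ^ k) ((n + 1) * (1 / 3 : ℝ) ^ k) ↔
      x / (1 / 3) ^ k - n ∈ Ico (0 : ℝ) 1 := by
  have hr : (0 : ℝ) < (1 / 3) ^ k := by positivity
  rw [mem_Ico, mem_Ico, sub_nonneg, le_div_iff₀ hr, sub_lt_iff_lt_add', div_lt_iff₀ hr]

theorem cantorCell_subset {α : ℝ} (hα : 0 < α) {k n : ℕ} (hn : n ∈ cantorLeft k) :
    cantorCell α k n ⊆ Icc 0 1 ×ˢ Icc 0 1 := by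
  rintro z ⟨h1, h2⟩
  have hr : (0 : ℝ) < (1 / 3) ^ k := by positivity
  have hr1 : (1 / 3 : ℝ) ^ k ≤ 1 := pow_le_one₀ (by norm_num) (by norm_num)
  have hk : (3 : ℝ) ^ k * (1 / 3) ^ k = 1 := by rw [← mul_pow]; norm_num
  have hlt : (n : ℝ) + 1 ≤ 3 ^ k := by exact_mod_cast cantorLeft_lt hn
  refine ⟨⟨le_trans (by positivity) h1.1, h1.2.le.trans ?_⟩, (pos_of_mem_cantorHeights h2).le,
    h2.2.le.trans (Real.rpow_le_one (by positivity) (by linarith) hα.le)⟩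
  exact (mul_le_mul_of_nonneg_right hlt hr.le).trans_eq hk

theorem measurableSet_cantorCell (α : ℝ) (k n : ℕ) : MeasurableSet (cantorCell α k n) :=
  measurableSet_Ico.prod (measurableSet_cantorHeights α k)

theorem volume_cantorCell_le {α : ℝ} (hα : 0 < α) (k n : ℕ) :
    volume (cantorCell α k n) ≤ ENNReal.ofReal ((1 / 3) ^ k * cantorScale α k) := by
  rw [cantorCell, Measure.volume_eq_prod, Measure.prod_prod, Real.volume_Ico,
    ENNReal.ofReal_mul (by positivity)]
  refine mul_le_mul' (ENNReal.ofReal_le_ofReal ?_) (volume_cantorHeights_le hα k)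
  linarith

theorem disjoint_cantorCell (α : ℝ) (k : ℕ) {n n' : ℕ} (h : n ≠ n') :
    Disjoint (cantorCell α k n) (cantorCell α k n') := by
  rw [disjoint_left]
  rintro z ⟨h1, -⟩ ⟨h2, -⟩
  rw [mem_Ico_rescale_iff] at h1 h2
  have e1 : (n : ℝ) < n' + 1 := by linarith [h1.1, h2.2]
  have e2 : (n' : ℝ) < n + 1 := by linarith [h2.1, h1.2]
  norm_cast at e1 e2
  omega

/-- A bump that is constant except near `m - 1 / 6` and `m + 1 / 6`. -/
noncomputable def annularBump (m : ℝ) : ContDiffBump m :=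
  ⟨1 / 6 - 1 / 100, 1 / 6 + 1 / 100, by norm_num, by norm_num⟩

theorem mem_of_deriv_annularBump_ne_zero {m x : ℝ} (h : deriv (annularBump m) x ≠ 0) :
    |x - m| ∈ Icc (1 / 6 - 1 / 100 : ℝ) (1 / 6 + 1 / 100) := by
  constructor
  · by_contra! hlt
    have : (annularBump m : ℝ → ℝ) =ᶠ[nhds x] 1 :=
      (annularBump m).eventuallyEq_one_of_mem_ball (by rwa [Metric.mem_ball, Real.dist_eq])
    exact h (by rw [this.deriv_eq]; simp [Pi.one_def])
  · have := support_deriv_subset (Function.mem_support.2 h)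
    rwa [(annularBump m).tsupport_eq, Metric.mem_closedBall, Real.dist_eq] at this

/-- The test function on the cell `cantorCell α k n` which detects the jump. -/
noncomputable def cellTest (α m : ℝ) (φ : ℝ → ℝ) (k n : ℕ) (z : ℝ × ℝ) : ℝ :=
  annularBump m (z.1 / (1 / 3) ^ k - n) * φ (z.2 / cantorScale α k)

section

variable {α m : ℝ} {φ : ℝ → ℝ}

theorem contDiff_cellTest (hd : ContDiff ℝ ∞ φ) (k n : ℕ) :
    ContDiff ℝ ∞ (cellTest α m φ k n) := by
  unfold cellTest
  exact ((annularBump m).contDiff.comp ((contDiff_fst.div_const _).sub contDiff_const)).mul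
    (hd.comp (contDiff_snd.div_const _))

theorem cellTest_eq_zero (hm : 1 / 6 + 1 / 100 ≤ m) (hm' : m + (1 / 6 + 1 / 100) ≤ 1)
    (hφ : Function.support φ ⊆ cantorUnitHeights α) {k n : ℕ} {z : ℝ × ℝ}
    (hz : z ∉ cantorCell α k n) : cellTest α m φ k n z = 0 := by
  by_contra h
  obtain ⟨h1, h2⟩ := mul_ne_zero_iff.1 h
  refine hz ⟨?_, div_cantorScale_mem_iff.1 (hφ h2)⟩
  have h3 : z.1 / (1 / 3) ^ k - n ∈ Function.support (annularBump m) := h1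
  rw [(annularBump m).support_eq, Metric.mem_ball, Real.dist_eq] at h3
  have h4 : |z.1 / (1 / 3) ^ k - n - m| < 1 / 6 + 1 / 100 := h3
  rw [abs_lt] at h4
  rw [mem_Ico_rescale_iff]
  constructor <;> linarith [h4.1, h4.2]

theorem tsupport_cellTest_subset (hα : 0 < α) (hm : 1 / 6 + 1 / 100 ≤ m)
    (hm' : m + (1 / 6 + 1 / 100) ≤ 1) (hφ : Function.support φ ⊆ cantorUnitHeights α) {k n : ℕ}
    (hn : n ∈ cantorLeft k) : tsupport (cellTest α m φ k n) ⊆ Icc 0 1 ×ˢ Icc 0 1 := by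
  refine closure_minimal (fun z hz => ?_) (isClosed_Icc.prod isClosed_Icc)
  by_contra h
  exact hz (cellTest_eq_zero hm hm' hφ fun hz' => h (cantorCell_subset hα hn hz'))

theorem fderiv_cellTest (hd : ContDiff ℝ ∞ φ) (k n : ℕ) (z : ℝ × ℝ) :
    fderiv ℝ (cellTest α m φ k n) z (1, 0) =
      deriv (annularBump m) (z.1 / (1 / 3) ^ k - n) / (1 / 3) ^ k * φ (z.2 / cantorScale α k) := by
  have h1 : HasDerivAt (fun x => cellTest α m φ k n (x, z.2))
      (fderiv ℝ (cellTest α m φ k n) z (1, 0)) z.1 := by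
    have h := ((contDiff_cellTest (α := α) (m := m) hd k n).differentiable (by simp) z).hasFDerivAt
    exact h.comp_hasDerivAt z.1 ((hasDerivAt_id z.1).prodMk (hasDerivAt_const z.1 z.2))
  have h2 : HasDerivAt (fun x : ℝ => annularBump m (x / (1 / 3) ^ k - n))
      (deriv (annularBump m) (z.1 / (1 / 3) ^ k - n) * (1 / (1 / 3) ^ k)) z.1 := by
    have h3 : HasDerivAt (annularBump m) (deriv (annularBump m) (z.1 / (1 / 3) ^ k - n))
        (z.1 / (1 / 3) ^ k - n) :=
      (((annularBump m).contDiff (n := 1)).differentiable one_ne_zero _).hasDerivAt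
    exact HasDerivAt.comp (h₂ := annularBump m) (h := fun x => x / (1 / 3) ^ k - n) z.1 h3
      (((hasDerivAt_id z.1).div_const _).sub_const _)
  refine h1.unique ((h2.mul_const (φ (z.2 / cantorScale α k))).congr_deriv ?_)
  rw [mul_one_div]

/-- Only the rising half of the bump is integrated, from `0` up to its value `1` at the centre; the
factor `3 ^ k` of the chain rule cancels against the change of variables. -/
theorem integral_annularBump_rescale (m : ℝ) (k n : ℕ) :
    ∫ x : ℝ, (Iic m).indicator (deriv (annularBump m)) (x / (1 / 3) ^ k - n) / (1 / 3) ^ k = 1 := by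
  have hr : (0 : ℝ) < (1 / 3) ^ k := by positivity
  rw [integral_div, Measure.integral_comp_div
    (fun x => (Iic m).indicator (deriv (annularBump m)) (x - n)),
    integral_sub_right_eq_self (fun x => (Iic m).indicator (deriv (annularBump m)) x),
    integral_indicator measurableSet_Iic,
    (annularBump m).hasCompactSupport.integral_Iic_deriv_eq (annularBump m).contDiff,
    abs_of_pos hr, (annularBump m).one_of_mem_closedBall
      (Metric.mem_closedBall_self (annularBump m).rIn_pos.le)]
  simp

/-- The derivative of the bump lives near `m - 1/6`, the centre of the block, and near `m + 1/6`,
which lies in no block. Only the left part sees `u`, whence the indicator of `Iic m`. -/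
theorem levelSum_mul_fderiv_cellTest {l : ℝ} {a : ℕ → ℝ} (hα : 0 < α)
    (hlm : l + 1 / 3 = m)
    (hφ : Function.support φ ⊆ cantorUnitHeights α) (hd : ContDiff ℝ ∞ φ) {k n : ℕ}
    (hn : n ∈ cantorLeft k) (z : ℝ × ℝ) :
    levelSum α l m a φ z * fderiv ℝ (cellTest α m φ k n) z (1, 0) =
      (Iic m).indicator (deriv (annularBump m)) (z.1 / (1 / 3) ^ k - n) / (1 / 3) ^ k *
        (a k * φ (z.2 / cantorScale α k) ^ 2) := by
  have hr : (0 : ℝ) < (1 / 3) ^ k := by positivity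
  rw [fderiv_cellTest hd]
  by_cases hφz : φ (z.2 / cantorScale α k) = 0
  · simp [hφz]
  by_cases hθ : deriv (annularBump m) (z.1 / (1 / 3) ^ k - n) = 0
  · simp only [indicator_apply, hθ, ite_self, zero_div, zero_mul, mul_zero]
  have hx := mem_of_deriv_annularBump_ne_zero hθ
  rw [levelSum_eq_levelTerm hα hφ (div_cantorScale_mem_iff.1 (hφ hφz)), levelTerm]
  by_cases hle : z.1 / (1 / 3) ^ k - n ≤ m
  · rw [abs_of_nonpos (by linarith)] at hx
    have hmem : z.1 ∈ cantorBlocks l m k := by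
      refine mem_biUnion hn ⟨?_, ?_⟩
      · rw [← lt_div_iff₀ hr]
        linarith [hx.2]
      · rw [← div_lt_iff₀ hr]
        linarith [hx.1]
    rw [indicator_of_mem hmem, indicator_of_mem (by exact hle)]
    simp only [Pi.one_apply]
    ring
  · push Not at hle
    rw [abs_of_nonneg (by linarith)] at hx
    have hmem : z.1 ∉ cantorBlocks l m k := by
      simp only [cantorBlocks, mem_iUnion, not_exists]
      rintro n' hn' ⟨h1, h2⟩
      rw [← lt_div_iff₀ hr] at h1
      rw [← div_lt_iff₀ hr] at h2
      have e1 : (n : ℝ) < n' + 1 := by linarith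
      have e2 : (n' : ℝ) < n + 1 := by linarith [hx.2]
      norm_cast at e1 e2
      obtain rfl : n = n' := by omega
      linarith
    rw [indicator_of_notMem hmem, indicator_of_notMem (s := Iic m) (fun h => hle.not_ge h)]
    simp

/-- The horizontal derivative of the test function is supported in `Ω`, so the pairing with any
extension `w` is determined by `u` and equals `a k * cantorScale α k * ∫ φ ^ 2`. Integration by
parts moves it to the weak gradient, tested against a function bounded by `1` on the cell. -/
theorem le_lintegral_cantorCell {l : ℝ} {a : ℕ → ℝ} {Ω U : Set (ℝ × ℝ)} (hα : 0 < α)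
    (hl : 0 ≤ l) (hlm : l + 1 / 3 = m) (hm : m ≤ 2 / 3) (hΩ : CantorAdapted α l m Ω)
    (hφ : Function.support φ ⊆ cantorUnitHeights α) (hd : ContDiff ℝ ∞ φ)
    (hφ1 : ∀ y, |φ y| ≤ 1) (hsU : Icc 0 1 ×ˢ Icc 0 1 ⊆ U) {w : ℝ × ℝ → ℝ}
    {v : ℝ × ℝ → ℝ × ℝ} (hw : HasWeakGradientOn U w v)
    (hwu : w =ᵐ[volume.restrict Ω] levelSum α l m a φ) {k n : ℕ} (hn : n ∈ cantorLeft k) :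
    ENNReal.ofReal (|a k| * cantorScale α k * ∫ y, φ y ^ 2) ≤
      ∫⁻ z in cantorCell α k n, ‖v z‖ₑ ∂(volume.restrict U) := by
  have hm1 : 1 / 6 + 1 / 100 ≤ m := by linarith
  have hm2 : m + (1 / 6 + 1 / 100) ≤ 1 := by linarith
  have hsc := cantorScale_pos α k
  set η := cellTest α m φ k n with hη
  have hts : tsupport η ⊆ Icc 0 1 ×ˢ Icc 0 1 := tsupport_cellTest_subset hα hm1 hm2 hφ hn
  have hcs : HasCompactSupport η :=
    (isCompact_Icc.prod isCompact_Icc).of_isClosed_subset (isClosed_tsupport η) hts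
  have key := hw.fst η (contDiff_cellTest hd k n) hcs (hts.trans hsU)
  have hw' : ∀ᵐ z ∂(volume : Measure (ℝ × ℝ)), z ∈ Ω → w z = levelSum α l m a φ z :=
    (ae_restrict_iff' hΩ.measurable).1 hwu
  have hrhs : ∫ z in U, w z * fderiv ℝ η z (1, 0) = a k * cantorScale α k * ∫ y, φ y ^ 2 := by
    rw [setIntegral_eq_integral_of_forall_compl_eq_zero]
    · calc ∫ z, w z * fderiv ℝ η z (1, 0)
          = ∫ z : ℝ × ℝ, (Iic m).indicator (deriv (annularBump m)) (z.1 / (1 / 3) ^ k - n) /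
              (1 / 3) ^ k * (a k * φ (z.2 / cantorScale α k) ^ 2) := by
            refine integral_congr_ae ?_
            filter_upwards [hw'] with z hz
            rw [← levelSum_mul_fderiv_cellTest hα hlm hφ hd hn]
            by_cases h0 : fderiv ℝ η z (1, 0) = 0
            · rw [← hη, h0, mul_zero, mul_zero]
            · rw [hη, fderiv_cellTest hd] at h0
              obtain ⟨h1, h2⟩ := mul_ne_zero_iff.1 h0
              have h3 : deriv (annularBump m) (z.1 / (1 / 3) ^ k - n) ≠ 0 := fun h =>
                h1 (by rw [h, zero_div])
              have h4 := hΩ.mem k n hn z.2 (div_cantorScale_mem_iff.1 (hφ h2)) _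
                (mem_of_deriv_annularBump_ne_zero h3)
              rw [add_sub_cancel, div_mul_cancel₀ _ (by positivity)] at h4
              rw [hz h4]
        _ = a k * cantorScale α k * ∫ y, φ y ^ 2 := by
            rw [Measure.volume_eq_prod, integral_prod_mul
              (fun x => (Iic m).indicator (deriv (annularBump m)) (x / (1 / 3) ^ k - n) /
                (1 / 3) ^ k) (fun y => a k * φ (y / cantorScale α k) ^ 2),
              integral_annularBump_rescale, one_mul, integral_const_mul,
              Measure.integral_comp_div (fun y => φ y ^ 2), abs_of_pos hsc, smul_eq_mul,
              mul_assoc]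
    · intro z hz
      have : z ∉ tsupport (fderiv ℝ η) := fun h => hz (hsU (hts (tsupport_fderiv_subset ℝ h)))
      rw [image_eq_zero_of_notMem_tsupport this]
      simp
  have hφ2 : 0 ≤ ∫ y, φ y ^ 2 := integral_nonneg fun _ => sq_nonneg _
  calc ENNReal.ofReal (|a k| * cantorScale α k * ∫ y, φ y ^ 2)
      = ‖∫ z in U, η z * (v z).1‖ₑ := by
        rw [key, hrhs, Real.enorm_eq_ofReal_abs, abs_neg, abs_mul, abs_mul, abs_of_pos hsc,
          abs_of_nonneg hφ2]
    _ ≤ ∫⁻ z in U, ‖η z * (v z).1‖ₑ := enorm_integral_le_lintegral_enorm _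
    _ ≤ ∫⁻ z in U, (cantorCell α k n).indicator (fun z => ‖v z‖ₑ) z := by
        refine lintegral_mono fun z => ?_
        by_cases hz : z ∈ cantorCell α k n
        · rw [indicator_of_mem hz]
          refine enorm_le_iff_norm_le.2 ?_
          rw [norm_mul]
          have h1 : ‖η z‖ ≤ 1 := by
            rw [hη, cellTest, norm_mul, Real.norm_eq_abs, Real.norm_eq_abs,
              abs_of_nonneg (annularBump m).nonneg]
            exact mul_le_one₀ (annularBump m).le_one (abs_nonneg _) (hφ1 _)
          exact (mul_le_of_le_one_left (norm_nonneg _) h1).trans (norm_fst_le _)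
        · rw [hη, cellTest_eq_zero hm1 hm2 hφ hz]
          simp
    _ = ∫⁻ z in cantorCell α k n, ‖v z‖ₑ ∂(volume.restrict U) :=
        lintegral_indicator (measurableSet_cantorCell α k n) _

end

/-! ### Extendability forces a series to converge. -/

theorem lintegral_rpow_le_mul_lintegral_rpow {X E : Type*} [MeasurableSpace X]
    [NormedAddCommGroup E] {μ : Measure X} {f : X → E} (hf : AEStronglyMeasurable f μ) {q : ℝ}
    (hq : 1 ≤ q) :
    (∫⁻ x, ‖f x‖ₑ ∂μ) ^ q ≤ (∫⁻ x, ‖f x‖ₑ ^ q ∂μ) * μ univ ^ (q - 1) := by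
  have hq0 : 0 < q := by linarith
  have h := eLpNorm_le_eLpNorm_mul_rpow_measure_univ (p := 1) (q := ENNReal.ofReal q)
    (by simpa using hq) hf
  rw [eLpNorm_one_eq_lintegral_enorm, eLpNorm_eq_lintegral_rpow_enorm_toReal
    (by simpa using hq0) ENNReal.ofReal_ne_top, ENNReal.toReal_ofReal hq0.le] at h
  calc (∫⁻ x, ‖f x‖ₑ ∂μ) ^ q
      ≤ ((∫⁻ x, ‖f x‖ₑ ^ q ∂μ) ^ (1 / q) * μ univ ^ (1 / (1 : ℝ≥0∞).toReal - 1 / q)) ^ q :=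
        ENNReal.rpow_le_rpow h hq0.le
    _ = _ := by
        rw [ENNReal.mul_rpow_of_nonneg _ _ hq0.le, ← ENNReal.rpow_mul, ← ENNReal.rpow_mul,
          one_div_mul_cancel hq0.ne', ENNReal.rpow_one]
        congr 2
        field_simp
        simp

/-- Hölder on a cell of measure at most `3 ^ (-k) * cantorScale α k` turns the `L^1` bound into an
`L^q` bound. The cells are disjoint within and across generations, so all these bounds add up to at
most the finite integral of `‖v‖ ^ q` over a ball containing the unit square. -/
theorem summable_of_hasW1LocExtension {α l m : ℝ} {φ : ℝ → ℝ} {a : ℕ → ℝ} {Ω : Set (ℝ × ℝ)}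
    (hα : 0 < α) (hl : 0 ≤ l) (hlm : l + 1 / 3 = m) (hm : m ≤ 2 / 3) (hΩ : CantorAdapted α l m Ω)
    (hφ : Function.support φ ⊆ cantorUnitHeights α) (hd : ContDiff ℝ ∞ φ)
    (hφ1 : ∀ y, |φ y| ≤ 1) (hφ0 : 0 < ∫ y, φ y ^ 2) {q : ℝ} (hq : 1 ≤ q)
    (h : HasW1LocExtension (ENNReal.ofReal q) Ω (levelSum α l m a φ)) :
    Summable fun k => 2 ^ k * (1 / 3) ^ k * cantorScale α k * (|a k| / (1 / 3) ^ k) ^ q := by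
  have hq0 : 0 < q := by linarith
  obtain ⟨w, hw, hwu⟩ := h
  obtain ⟨-, v, hv, hvq⟩ := hw (Metric.ball 0 2) Metric.isOpen_ball Metric.isBounded_ball
    (subset_univ _)
  set ν : Measure (ℝ × ℝ) := volume.restrict (Metric.ball 0 2) with hν
  have hsU : Icc (0 : ℝ) 1 ×ˢ Icc (0 : ℝ) 1 ⊆ Metric.ball (0 : ℝ × ℝ) 2 := by
    rintro z ⟨h1, h2⟩
    rw [mem_ball_zero_iff, Prod.norm_def, max_lt_iff, Real.norm_eq_abs, Real.norm_eq_abs,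
      abs_of_nonneg h1.1, abs_of_nonneg h2.1]
    exact ⟨by linarith [h1.2], by linarith [h2.2]⟩
  set κ := ∫ y, φ y ^ 2 with hκ
  set T : ℕ → ℝ := fun k =>
    2 ^ k * (1 / 3) ^ k * cantorScale α k * (|a k| / (1 / 3) ^ k) ^ q with hT
  have hT0 : ∀ k, 0 ≤ T k := fun k => by
    have := cantorScale_pos α k
    positivity
  have hcell : ∀ k, ∀ n ∈ cantorLeft k, ENNReal.ofReal (κ ^ q * T k / 2 ^ k) ≤
      ∫⁻ z in cantorCell α k n, ‖v z‖ₑ ^ q ∂ν := by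
    intro k n hn
    have hsc := cantorScale_pos α k
    set r : ℝ := (1 / 3) ^ k with hr
    have hr0 : 0 < r := by positivity
    have h1 := le_lintegral_cantorCell hα hl hlm hm hΩ hφ hd hφ1 hsU hv hwu hn
    have h2 := lintegral_rpow_le_mul_lintegral_rpow
      (hvq.1.restrict (s := cantorCell α k n)) hq
    have h3 : (ν.restrict (cantorCell α k n)) univ ≤ ENNReal.ofReal (r * cantorScale α k) := by
      rw [Measure.restrict_apply_univ]
      exact (Measure.restrict_apply_le _ _).trans (volume_cantorCell_le hα k n)
    have h4 : ENNReal.ofReal ((|a k| * cantorScale α k * κ) ^ q) ≤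
        (∫⁻ z in cantorCell α k n, ‖v z‖ₑ ^ q ∂ν) *
          ENNReal.ofReal ((r * cantorScale α k) ^ (q - 1)) := by
      rw [← ENNReal.ofReal_rpow_of_nonneg (by positivity) hq0.le,
        ← ENNReal.ofReal_rpow_of_nonneg (by positivity) (by linarith)]
      exact (ENNReal.rpow_le_rpow h1 hq0.le).trans (h2.trans
        (mul_le_mul_right (ENNReal.rpow_le_rpow h3 (by linarith)) _))
    have h5 : 0 < (r * cantorScale α k) ^ (q - 1) := by positivity
    refine le_trans (le_of_eq ?_) (ENNReal.div_le_of_le_mul h4)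
    rw [← ENNReal.ofReal_div_of_pos h5]
    congr 1
    rw [eq_div_iff h5.ne', Real.rpow_sub_one (by positivity), Real.mul_rpow hr0.le hsc.le,
      Real.mul_rpow (by positivity) hφ0.le, Real.mul_rpow (abs_nonneg _) hsc.le, hT]
    simp only
    rw [← hr, Real.div_rpow (abs_nonneg _) hr0.le]
    have : r ^ q ≠ 0 := by positivity
    field_simp
  have hlevel : ∀ k, ENNReal.ofReal (κ ^ q * T k) ≤
      ∫⁻ z in ⋃ n ∈ cantorLeft k, cantorCell α k n, ‖v z‖ₑ ^ q ∂ν := by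
    intro k
    rw [lintegral_biUnion_finset (fun n _ n' _ hne => disjoint_cantorCell α k hne)
      (fun n _ => measurableSet_cantorCell α k n)]
    refine le_trans (le_of_eq ?_) (Finset.sum_le_sum (hcell k))
    rw [Finset.sum_const, card_cantorLeft, nsmul_eq_mul, ENNReal.ofReal_div_of_pos (by positivity),
      ENNReal.ofReal_pow zero_le_two]
    push_cast
    rw [ENNReal.ofReal_ofNat, ENNReal.mul_div_cancel (by simp) (by simp)]
  have hsum : ∑' k, ENNReal.ofReal (κ ^ q * T k) ≠ ⊤ := by
    refine ne_top_of_le_ne_top ?_ (ENNReal.tsum_le_tsum hlevel)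
    rw [← lintegral_iUnion]
    · refine ne_top_of_le_ne_top ?_ (setLIntegral_le_lintegral _ _)
      have h1 := lintegral_rpow_enorm_lt_top_of_eLpNorm_lt_top (by simpa using hq0)
        ENNReal.ofReal_ne_top hvq.2
      rw [ENNReal.toReal_ofReal hq0.le] at h1
      exact h1.ne
    · exact fun k => Finset.measurableSet_biUnion _ fun n _ => measurableSet_cantorCell α k n
    · intro j k hjk
      refine ((pairwise_disjoint_cantorHeights hα hjk).preimage Prod.snd).mono ?_ ?_
      · exact iUnion₂_subset fun n _ z hz => hz.2
      · exact iUnion₂_subset fun n _ z hz => hz.2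
  have h1 := ENNReal.summable_toReal hsum
  have h2 : ∀ k, (ENNReal.ofReal (κ ^ q * T k)).toReal = κ ^ q * T k := fun k =>
    ENNReal.toReal_ofReal (mul_nonneg (by positivity) (hT0 k))
  simp only [h2] at h1
  exact (summable_mul_left_iff (by positivity)).1 h1

theorem HasW1LocExtension.mono {p q : ℝ≥0∞} (hpq : p ≤ q) {Ω : Set (ℝ × ℝ)} {u : ℝ × ℝ → ℝ}
    (h : HasW1LocExtension q Ω u) : HasW1LocExtension p Ω u := by
  obtain ⟨w, hw, hwu⟩ := h
  refine ⟨w, fun U hU hb hc => ?_, hwu⟩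
  obtain ⟨h1, v, h2, h3⟩ := hw U hU hb hc
  have : IsFiniteMeasure (volume.restrict U) := ⟨by
    rw [Measure.restrict_apply_univ]
    exact hb.measure_lt_top⟩
  exact ⟨h1.mono_exponent hpq, v, h2, h3.mono_exponent hpq⟩

theorem exists_memW1_not_hasW1LocExtension {α l m : ℝ} {a : ℕ → ℝ} {Ω : Set (ℝ × ℝ)}
    (hα : 0 < α) (hl : 0 ≤ l) (hlm : l + 1 / 3 = m) (hm : m ≤ 2 / 3) (hΩ : CantorAdapted α l m Ω)
    {p : ℝ≥0∞} (hp : 1 ≤ p) (hpa : LevelSummable α p fun k => a k / cantorScale α k)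
    {q : ℝ} (hq : 1 ≤ q)
    (hqa : ¬ Summable fun k =>
      2 ^ k * (1 / 3) ^ k * cantorScale α k * (|a k| / (1 / 3) ^ k) ^ q) :
    ∃ u : ℝ × ℝ → ℝ, MemW1 p Ω u ∧ ¬ HasW1LocExtension (ENNReal.ofReal q) Ω u := by
  -- Any base strictly between `1/54` and `1/27` would do in place of `1/40`.
  have hx : cantorUnitHeights α ∈ nhds ((1 / 40 : ℝ) ^ α) :=
    isOpen_Ioo.mem_nhds ⟨Real.rpow_lt_rpow (by norm_num) (by norm_num) hα,
      Real.rpow_lt_rpow (by norm_num) (by norm_num) hα⟩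
  obtain ⟨φ, hφ, hc, hd, hr, hφx⟩ := exists_contDiff_tsupport_subset (n := ⊤) hx
  have hφ1 : ∀ y, |φ y| ≤ 1 := fun y => by
    have := hr (mem_range_self y)
    rw [abs_of_nonneg this.1]
    exact this.2
  have hφ0 : 0 < ∫ y, φ y ^ 2 := by
    refine (hd.continuous.pow 2).integral_pos_of_hasCompactSupport_nonneg_nonzero
      (x := (1 / 40 : ℝ) ^ α) ?_ (fun y => sq_nonneg _) (by rw [hφx]; norm_num)
    exact hc.comp_left (g := fun x : ℝ => x ^ 2) (by norm_num)
  refine ⟨levelSum α l m a φ, memW1_levelSum hα (by linarith) hΩ hφ hc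
    (hd.of_le (by exact_mod_cast le_top)) hp hpa, fun h => hqa ?_⟩
  exact summable_of_hasW1LocExtension hα hl hlm hm hΩ ((subset_tsupport φ).trans hφ) hd hφ1 hφ0 hq h

/-! ### Power coefficients with a polynomial correction. -/

theorem two_pow_eq_rpow_cantorDim (k : ℕ) : (2 : ℝ) ^ k = ((1 / 3 : ℝ) ^ k) ^ (-cantorDim) := by
  have h3 : Real.log 3 ≠ 0 := (Real.log_pos (by norm_num)).ne'
  have h : (1 / 3 : ℝ) ^ (-cantorDim) = 2 := by
    rw [Real.rpow_def_of_pos (by norm_num), one_div, Real.log_inv, neg_mul_neg, cantorDim,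
      mul_div_cancel₀ _ h3, Real.exp_log (by norm_num)]
  rw [← Real.rpow_natCast_mul (by norm_num), mul_comm, Real.rpow_mul_natCast (by norm_num), h]

theorem cantorDim_pos : 0 < cantorDim :=
  div_pos (Real.log_pos (by norm_num)) (Real.log_pos (by norm_num))

theorem cantorDim_lt_one : cantorDim < 1 :=
  (div_lt_one (Real.log_pos (by norm_num))).2 (Real.log_lt_log (by norm_num) (by norm_num))

/-- The coefficients `3 ^ (-γ k) (k + 1) ^ (-d)`. -/
noncomputable def powerCoeff (γ d : ℝ) (k : ℕ) : ℝ := ((1 / 3 : ℝ) ^ k) ^ γ * (k + 1 : ℝ) ^ (-d)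

theorem powerCoeff_nonneg (γ d : ℝ) (k : ℕ) : 0 ≤ powerCoeff γ d k := by
  unfold powerCoeff
  positivity

/-- One computation serves both series: `β = α` for membership in `W^{1,p}`, and `β = 1` with `q` in
place of `p` for extendability. -/
theorem weighted_powerCoeff_rpow (α β γ d p : ℝ) (k : ℕ) :
    2 ^ k * (1 / 3) ^ k * cantorScale α k * (powerCoeff γ d k / ((1 / 3 : ℝ) ^ k) ^ β) ^ p =
      powerCoeff (1 + α - cantorDim + p * (γ - β)) (d * p) k := by
  rw [two_pow_eq_rpow_cantorDim, powerCoeff, powerCoeff, cantorScale]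
  set t : ℝ := (1 / 3) ^ k with ht
  have ht0 : 0 < t := by positivity
  have e1 : t ^ γ * (k + 1 : ℝ) ^ (-d) / t ^ β = t ^ (γ - β) * (k + 1 : ℝ) ^ (-d) := by
    rw [Real.rpow_sub ht0]
    ring
  have e2 : t ^ (1 + α - cantorDim + p * (γ - β)) =
      t ^ (-cantorDim) * t * t ^ α * (t ^ (γ - β)) ^ p := by
    rw [← Real.rpow_mul ht0.le, show t ^ (-cantorDim) * t = t ^ (-cantorDim) * t ^ (1 : ℝ) by
      rw [Real.rpow_one], ← Real.rpow_add ht0, ← Real.rpow_add ht0, ← Real.rpow_add ht0]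
    congr 1
    ring
  rw [e1, Real.mul_rpow (by positivity) (by positivity), e2, ← Real.rpow_mul (by positivity) (-d), neg_mul]
  ring

theorem powerCoeff_le_rpow_left {e f : ℝ} (hf : 0 ≤ f) (k : ℕ) :
    powerCoeff e f k ≤ ((1 / 3 : ℝ) ^ k) ^ e :=
  mul_le_of_le_one_right (by positivity)
    (Real.rpow_le_one_of_one_le_of_nonpos (by simp) (by linarith))

theorem powerCoeff_le_rpow_right {e f : ℝ} (he : 0 ≤ e) (k : ℕ) :
    powerCoeff e f k ≤ (k + 1 : ℝ) ^ (-f) :=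
  mul_le_of_le_one_left (by positivity)
    (Real.rpow_le_one (by positivity) (pow_le_one₀ (by norm_num) (by norm_num)) he)

theorem summable_powerCoeff {e f : ℝ} (h : (0 < e ∧ 0 ≤ f) ∨ (0 ≤ e ∧ 1 < f)) :
    Summable (powerCoeff e f) := by
  obtain ⟨he, hf⟩ | ⟨he, hf⟩ := h
  · refine Summable.of_nonneg_of_le (powerCoeff_nonneg e f) (powerCoeff_le_rpow_left hf) ?_
    have : ∀ k : ℕ, ((1 / 3 : ℝ) ^ k) ^ e = ((1 / 3 : ℝ) ^ e) ^ k := fun k => by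
      rw [← Real.rpow_natCast_mul (by norm_num), mul_comm, Real.rpow_mul_natCast (by norm_num)]
    simp only [this]
    exact summable_geometric_of_lt_one (by positivity)
      (Real.rpow_lt_one (by norm_num) (by norm_num) he)
  · refine Summable.of_nonneg_of_le (powerCoeff_nonneg e f) (powerCoeff_le_rpow_right he) ?_
    have h := (summable_nat_add_iff 1).2 (Real.summable_nat_rpow_inv.2 hf)
    refine h.congr fun k => ?_
    rw [Real.rpow_neg (by positivity)]
    push_cast
    rfl

theorem not_summable_powerCoeff {e f : ℝ} (he : e ≤ 0) (hf : f ≤ 1) :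
    ¬ Summable (powerCoeff e f) := by
  intro h
  refine Real.not_summable_natCast_inv ((summable_nat_add_iff 1).1
    (h.of_nonneg_of_le (fun k => by positivity) fun k => ?_))
  calc ((k + 1 : ℕ) : ℝ)⁻¹ = 1 * (k + 1 : ℝ) ^ (-1 : ℝ) := by
        rw [Real.rpow_neg_one, one_mul]
        push_cast
        rfl
    _ ≤ powerCoeff e f k := by
        refine mul_le_mul ?_ ?_ (by positivity) (by positivity)
        · exact Real.one_le_rpow_of_pos_of_le_one_of_nonpos (by positivity)
            (pow_le_one₀ (by norm_num) (by norm_num)) he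
        · exact Real.rpow_le_rpow_of_exponent_le (by simp) (by linarith)

theorem levelSummable_powerCoeff {α γ d : ℝ} {p : ℝ≥0∞} (hp : p ≠ ⊤)
    (h : (0 < 1 + α - cantorDim + p.toReal * (γ - α) ∧ 0 ≤ d * p.toReal) ∨
      (0 ≤ 1 + α - cantorDim + p.toReal * (γ - α) ∧ 1 < d * p.toReal)) :
    LevelSummable α p fun k => powerCoeff γ d k / cantorScale α k := by
  refine Or.inr ⟨hp, (summable_powerCoeff h).congr fun k => ?_⟩
  rw [abs_of_nonneg (div_nonneg (powerCoeff_nonneg _ _ _) (cantorScale_pos α k).le),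
    ← weighted_powerCoeff_rpow]
  rfl

theorem levelSummable_top_powerCoeff {α γ d : ℝ} (hγ : α ≤ γ) (hd : 0 ≤ d) :
    LevelSummable α ⊤ fun k => powerCoeff γ d k / cantorScale α k := by
  refine Or.inl ⟨rfl, 1, fun k => ?_⟩
  rw [abs_of_nonneg (div_nonneg (powerCoeff_nonneg _ _ _) (cantorScale_pos α k).le),
    div_le_one (cantorScale_pos α k)]
  exact (powerCoeff_le_rpow_left hd k).trans (Real.rpow_le_rpow_of_exponent_ge (by positivity)
    (pow_le_one₀ (by norm_num) (by norm_num)) hγ)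

theorem exists_not_hasW1LocExtension_cantor {α γ d : ℝ} (hα : 0 < α) {p : ℝ≥0∞} (hp : 1 ≤ p)
    (hpa : LevelSummable α p fun k => powerCoeff γ d k / cantorScale α k) {q : ℝ} (hq : 1 ≤ q)
    (hγ : 1 + α - cantorDim + q * (γ - 1) ≤ 0) (hd : d * q ≤ 1) :
    (∃ u : ℝ × ℝ → ℝ, MemW1 p (cantorLower α) u ∧
      ¬ HasW1LocExtension (ENNReal.ofReal q) (cantorLower α) u) ∧
    (∃ u : ℝ × ℝ → ℝ, MemW1 p (cantorUpper α) u ∧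
      ¬ HasW1LocExtension (ENNReal.ofReal q) (cantorUpper α) u) := by
  have h : ¬ Summable fun k =>
      2 ^ k * (1 / 3) ^ k * cantorScale α k * (|powerCoeff γ d k| / (1 / 3) ^ k) ^ q := by
    refine fun hs => not_summable_powerCoeff hγ hd (hs.congr fun k => ?_)
    rw [abs_of_nonneg (powerCoeff_nonneg _ _ _), ← weighted_powerCoeff_rpow, Real.rpow_one]
  exact ⟨exists_memW1_not_hasW1LocExtension hα (by norm_num) (by norm_num) (by norm_num)
      (cantorAdapted_cantorLower hα) hp hpa hq h,
    exists_memW1_not_hasW1LocExtension hα (by norm_num) (by norm_num) (by norm_num)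
      (cantorAdapted_cantorUpper hα) hp hpa hq h⟩

/-! ### Choice of the exponents. -/

theorem proposition1p2 :
    -- (1)
    (∀ α : ℝ, 0 < α → α ≤ Real.log 2 / (2 * Real.log 3) →
      ∀ p : ℝ≥0∞, 1 ≤ p →
        (∃ u : ℝ × ℝ → ℝ, MemW1 p (cantorLower α) u ∧ ¬ HasW1LocExtension 1 (cantorLower α) u) ∧
        (∃ u : ℝ × ℝ → ℝ, MemW1 p (cantorUpper α) u ∧ ¬ HasW1LocExtension 1 (cantorUpper α) u)) ∧
    -- (2)
    (∀ α : ℝ, Real.log 2 / (2 * Real.log 3) < α → α < 1 →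
      ∀ p : ℝ, 1 ≤ p → p ≤ (1 + α - cantorDim) / (2 * α - cantorDim) →
        (∃ u : ℝ × ℝ → ℝ, MemW1 (ENNReal.ofReal p) (cantorLower α) u ∧
          ¬ HasW1LocExtension 1 (cantorLower α) u) ∧
        (∃ u : ℝ × ℝ → ℝ, MemW1 (ENNReal.ofReal p) (cantorUpper α) u ∧
          ¬ HasW1LocExtension 1 (cantorUpper α) u)) ∧
    -- (3)
    (∀ α : ℝ, Real.log 2 / (2 * Real.log 3) < α → α < 1 →
      ∀ p : ℝ, (1 + α - cantorDim) / (2 * α - cantorDim) < p →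
      ∀ q : ℝ, ((1 + α - cantorDim) * p) / (1 + α - cantorDim + (1 - α) * p) ≤ q →
        (∃ u : ℝ × ℝ → ℝ, MemW1 (ENNReal.ofReal p) (cantorLower α) u ∧
          ¬ HasW1LocExtension (ENNReal.ofReal q) (cantorLower α) u) ∧
        (∃ u : ℝ × ℝ → ℝ, MemW1 (ENNReal.ofReal p) (cantorUpper α) u ∧
          ¬ HasW1LocExtension (ENNReal.ofReal q) (cantorUpper α) u)) := by
  have hs : Real.log 2 / (2 * Real.log 3) = cantorDim / 2 := by
    rw [cantorDim, mul_comm, div_div]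
  have hs0 := cantorDim_pos
  have hs1 := cantorDim_lt_one
  rw [hs, ← ENNReal.ofReal_one]
  refine ⟨fun α hα hαs p hp => ?_, fun α hαs hα1 p hp hps => ?_,
    fun α hαs hα1 p hps q hq => ?_⟩
  -- With `q = 1` this `γ` makes the extension exponent exactly `0`, so the terms of that series do
  -- not decay.
  · refine exists_not_hasW1LocExtension_cantor (γ := cantorDim - α) (d := 0) hα
      (by simpa using hp) ?_ le_rfl (by linarith) (by norm_num)
    by_cases hpt : p = ⊤
    · rw [hpt]
      exact levelSummable_top_powerCoeff (by linarith) le_rfl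
    · refine levelSummable_powerCoeff hpt (Or.inl ⟨?_, by simp⟩)
      have : 0 ≤ p.toReal * (cantorDim - α - α) :=
        mul_nonneg ENNReal.toReal_nonneg (by linarith)
      linarith
  · have hE : 0 < 2 * α - cantorDim := by linarith
    have hp' : 1 ≤ ENNReal.ofReal p := by simpa using hp
    have hpr : (ENNReal.ofReal p).toReal = p := ENNReal.toReal_ofReal (by linarith)
    rw [le_div_iff₀ hE] at hps
    obtain hlt | heq := hps.lt_or_eq
    · refine exists_not_hasW1LocExtension_cantor (γ := cantorDim - α) (d := 0) (by linarith)
        hp' (levelSummable_powerCoeff ENNReal.ofReal_ne_top (Or.inl ⟨?_, by simp⟩)) le_rfl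
        (by linarith) (by norm_num)
      rw [hpr]
      linarith
    -- At the endpoint both exponents vanish. With `d = 1` the extension series is harmonic, while
    -- the membership series is `∑ (k + 1) ^ (-p)` with `p > 1`, because `α < 1`.
    · refine exists_not_hasW1LocExtension_cantor (γ := cantorDim - α) (d := 1) (by linarith)
        hp' (levelSummable_powerCoeff ENNReal.ofReal_ne_top (Or.inr ⟨?_, ?_⟩)) le_rfl
        (by linarith) (by norm_num)
      · rw [hpr]
        linarith
      · rw [hpr, one_mul]
        nlinarith
  · have hE : 0 < 2 * α - cantorDim := by linarith
    have hα : 0 < α := by linarith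
    set E := 1 + α - cantorDim with hEdef
    have hE0 : 0 < E := by linarith
    have hp1 : 1 < p := lt_trans ((one_lt_div hE).2 (by linarith)) hps
    have hp0 : 0 < p := by linarith
    rw [div_lt_iff₀ hE] at hps
    have hD : 0 < E + (1 - α) * p := by
      have := mul_pos (sub_pos.2 hα1) hp0
      linarith
    set q₀ := E * p / (E + (1 - α) * p) with hq₀
    have hq1 : 1 ≤ q₀ := by
      rw [hq₀, one_le_div hD]
      linarith
    have hpr : (ENNReal.ofReal p).toReal = p := ENNReal.toReal_ofReal hp0.le
    -- This `γ` makes the membership exponent vanish, and `q₀` is the value for which the extension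
    -- exponent vanishes too. With `d = 1 / q₀` the series are `∑ (k + 1) ^ (-p / q₀)`, where `p >
    -- q₀`, and the harmonic series. Larger `q` reduce to `q₀`, as bounded sets have finite measure.
    have key := exists_not_hasW1LocExtension_cantor (γ := α - E / p) (d := 1 / q₀) hα
      (p := ENNReal.ofReal p) (by simpa using hp1.le)
      (levelSummable_powerCoeff ENNReal.ofReal_ne_top (Or.inr ⟨?_, ?_⟩)) hq1 ?_ ?_
    · have hmono := ENNReal.ofReal_le_ofReal hq
      exact ⟨key.1.imp fun u hu => ⟨hu.1, fun h => hu.2 (h.mono hmono)⟩,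
        key.2.imp fun u hu => ⟨hu.1, fun h => hu.2 (h.mono hmono)⟩⟩
    · rw [hpr, ← hEdef]
      refine le_of_eq ?_
      field_simp
      ring
    · rw [hpr, one_div_mul_eq_div, one_lt_div (by linarith), hq₀, div_lt_iff₀ hD]
      have := mul_pos hp0 (mul_pos (sub_pos.2 hα1) hp0)
      linarith
    · have h : α - E / p - 1 = -((E + (1 - α) * p) / p) := by
        field_simp
        ring
      rw [← hEdef, h, mul_neg, hq₀, div_mul_div_cancel₀ hD.ne', mul_div_cancel_right₀ _ hp0.ne',
        add_neg_cancel]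
    · rw [one_div_mul_cancel (by linarith)]
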